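/- Let $k\ge 0$, let $n_0,\dots,n_k\ge 0$ be integers, and put $\mathbb{C}[\varepsilon_i]=\mathbb{C}[X]/(X^{n_i+1})$, where $\varepsilon_i$ is the class of $X$. Let $t_0,\dots,t_k\in\mathbb{C}\setminus\{0,1\}$ be pairwise distinct and let $x\in\mathbb{C}\setminus\{0,1,t_0,\dots,t_k\}$. For $s\in\mathbb{C}\setminus\{0,1,x\}$ let \[g_{t_i+\varepsilon_i,x}(s)=\begin{pmatrix}-(s-1)x & (t_i+\varepsilon_i)s(s-1)\\ -(s-x) & s(s-x)\end{pmatrix}\in \mathrm{PGL}_2(\mathbb{C}[\varepsilon_i]),\qquad g_{s,x}=\bigl(g_{t_i+\varepsilon_i,x}(s)\bigr)_{0\le i\le k}\in \mathbf{G}=\prod_{i=0}^k \mathrm{PGL}_2(\mathbb{C}[\varepsilon_i]).\] (a) The elements $g_{s,x}$, $s\in\mathbb{C}\setminus\{0,1,x\}$, generate a dense subgroup of the complex Lie group $\mathbf{G}$ (in its usual topology, coming from that of $\mathbb{C}$). (b) Let $m=1+\sum_{i=0}^k (n_i+1)$ and $N=4m$. Then the rational map $\phi_N:\mathbb{A}^N_{\mathbb{C}}\dashrightarrow\mathbf{G}$,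 $(s_1,\dots,s_N)\mapsto g_{s_1,x}\cdots g_{s_N,x}$, defined where all $s_j\notin\{0,1,x\}$, is dominant: its image is Zariski-dense in $\mathbf{G}$, regarded as an algebraic group over $\mathbb{C}$ of dimension $3\sum_{i=0}^k (n_i+1)$. -/

import Mathlib

open scoped MatrixGroups Polynomial

noncomputable section

namespace WildHecke

/-- The truncated polynomial ring `ℂ[ε] = ℂ[X] / (X ^ (n + 1))`. -/
abbrev TruncPoly (n : ℕ) : Type := AdjoinRoot (Polynomial.X ^ (n + 1) : ℂ[X])

/-- The class `ε` of `X`. -/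
def eps (n : ℕ) : TruncPoly n := AdjoinRoot.root _

/-- Inclusion of constants `ℂ → ℂ[ε]`. -/
def const (n : ℕ) : ℂ →+* TruncPoly n := AdjoinRoot.of _

/-- The coefficients `(u₀, …, uₙ)` of `u = u₀ + u₁ ε + ⋯ + uₙ ε ^ n`. -/
def coeffs (n : ℕ) (u : TruncPoly n) (j : Fin (n + 1)) : ℂ :=
  (AdjoinRoot.modByMonicHom (Polynomial.monic_X_pow (n + 1)) u).coeff j

/-- The usual topology of `ℂ[ε]`, identified with `ℂ ^ (n + 1)` through the coefficients. -/
instance (n : ℕ) : TopologicalSpace (TruncPoly n) :=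
  TopologicalSpace.induced (coeffs n) inferInstance

/-- The usual topology of `PGL₂(R)` for a topological ring `R`: the quotient topology of `GL₂(R)`,
which is the unit group of the topological monoid of `2 × 2` matrices. For `R = ℂ[ε]` this is the
topology of the (complex) Lie group `PGL₂(ℂ[ε])`. -/
instance (R : Type*) [CommRing R] [TopologicalSpace R] : TopologicalSpace PGL(2, R) :=
  TopologicalSpace.coinduced (Matrix.ProjGenLinGroup.mk : GL (Fin 2) R → PGL(2, R)) inferInstance

/-- The matrix `g_{t + ε, x}(s)`. -/
def gMatrix (n : ℕ) (t x s : ℂ) : Matrix (Fin 2) (Fin 2) (TruncPoly n) :=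
  !![const n (-(s - 1) * x), (const n t + eps n) * const n (s * (s - 1));
     const n (-(s - x)), const n (s * (s - x))]

theorem eps_pow (n : ℕ) : eps n ^ (n + 1) = 0 := by
  have h := AdjoinRoot.mk_self (f := (Polynomial.X ^ (n + 1) : ℂ[X]))
  rwa [map_pow, AdjoinRoot.mk_X] at h

theorem isUnit_det_gMatrix (n : ℕ) {t x s : ℂ} (hxt : x ≠ t) (h0 : s ≠ 0) (h1 : s ≠ 1)
    (hx : s ≠ x) : IsUnit (gMatrix n t x s).det := by
  have hdet : (gMatrix n t x s).det
      = const n (s * (s - 1) * (s - x)) * (const n (t - x) + eps n) := by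
    simp only [gMatrix, Matrix.det_fin_two_of, map_mul, map_sub, map_neg, map_one]
    ring
  rw [hdet]
  have hnil : IsNilpotent (eps n) := ⟨n + 1, eps_pow n⟩
  have hu : IsUnit (const n (t - x)) := (sub_ne_zero.2 hxt.symm).isUnit.map (const n)
  refine IsUnit.mul ?_ (hnil.isUnit_add_left_of_commute hu (Commute.all _ _))
  exact (mul_ne_zero (mul_ne_zero h0 (sub_ne_zero.2 h1)) (sub_ne_zero.2 hx)).isUnit.map (const n)

/-- The parameters `s ∈ ℂ ∖ {0, 1, x}`. -/
abbrev Param (x : ℂ) : Type := {s : ℂ // s ≠ 0 ∧ s ≠ 1 ∧ s ≠ x}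

/-- The element `g_{t + ε, x}(s)` of `PGL₂(ℂ[ε])`. -/
def g (n : ℕ) (t x : ℂ) (hxt : x ≠ t) (s : Param x) : PGL(2, TruncPoly n) :=
  Matrix.ProjGenLinGroup.mk (Matrix.GeneralLinearGroup.mk'' (gMatrix n t x s)
    (isUnit_det_gMatrix n hxt s.2.1 s.2.2.1 s.2.2.2))

/-- The group `∏ᵢ PGL₂(ℂ[εᵢ])`, where `ℂ[εᵢ] = ℂ[X] / (X ^ (nᵢ + 1))`, for `i = 0, …, k`.
As a product it carries the product topology (of the usual topologies). -/
abbrev ProdPGL {k : ℕ} (n : Fin (k + 1) → ℕ) : Type := ∀ i, PGL(2, TruncPoly (n i))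

/-- The element `g_{s, x} = (g_{tᵢ + εᵢ, x}(s))ᵢ`. -/
def gTuple {k : ℕ} (n : Fin (k + 1) → ℕ) (t : Fin (k + 1) → ℂ) (x : ℂ) (hx : ∀ i, x ≠ t i)
    (s : Param x) : ProdPGL n :=
  fun i => g (n i) (t i) x (hx i) s

/-- The map `(s₁, …, s_N) ↦ g_{s₁, x} ⋯ g_{s_N, x}`, on the dense open subset of affine space
`𝔸 ^ N` where no coordinate is `0`, `1` or `x`. -/
def phi {k : ℕ} (n : Fin (k + 1) → ℕ) (t : Fin (k + 1) → ℂ) (x : ℂ) (hx : ∀ i, x ≠ t i)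
    (N : ℕ) (s : Fin N → Param x) : ProdPGL n :=
  (List.ofFn fun j => gTuple n t x hx (s j)).prod

/-- The Zariski topology of the affine space `ℂ ^ σ`: it is induced by the map that sends a point
to its maximal ideal. The closed sets are the zero loci of sets of polynomials. -/
@[reducible]
def zariskiAffine (σ : Type) : TopologicalSpace (σ → ℂ) :=
  TopologicalSpace.induced
    (MvPolynomial.pointToPoint : (σ → ℂ) → PrimeSpectrum (MvPolynomial σ ℂ)) inferInstance

/-- The index set of the complex coordinates on `∏ᵢ Mat₂(ℂ[εᵢ])`: a factor, a matrix entry, and a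
power of `εᵢ`. -/
abbrev Coord {k : ℕ} (n : Fin (k + 1) → ℕ) : Type :=
  Σ i : Fin (k + 1), Fin 2 × Fin 2 × Fin (n i + 1)

/-- The coordinates of an element of `∏ᵢ GL₂(ℂ[εᵢ])`; they identify this group with a principal
open subset (the non-vanishing of all constant terms of determinants) of an affine space. -/
def coords {k : ℕ} (n : Fin (k + 1) → ℕ) (A : ∀ i, GL (Fin 2) (TruncPoly (n i))) :
    Coord n → ℂ :=
  fun c => coeffs (n c.1) ((A c.1 : Matrix (Fin 2) (Fin 2) (TruncPoly (n c.1))) c.2.1 c.2.2.1)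
    c.2.2.2

/-- The Zariski topology of `∏ᵢ GL₂(ℂ[εᵢ])`, as a subvariety of affine space. -/
@[reducible]
def zariskiProdGL {k : ℕ} (n : Fin (k + 1) → ℕ) :
    TopologicalSpace (∀ i, GL (Fin 2) (TruncPoly (n i))) :=
  TopologicalSpace.induced (coords n) (zariskiAffine (Coord n))

/-- The Zariski topology of the algebraic group `∏ᵢ PGL₂(ℂ[εᵢ])` over `ℂ`: it is the quotient
variety of `∏ᵢ GL₂(ℂ[εᵢ])` by its algebraic subgroup of scalar matrices, and has the quotient
topology. -/
@[reducible]
def zariskiProdPGL {k : ℕ} (n : Fin (k + 1) → ℕ) : TopologicalSpace (ProdPGL n) :=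
  TopologicalSpace.coinduced
    (fun (A : ∀ i, GL (Fin 2) (TruncPoly (n i))) i => Matrix.ProjGenLinGroup.mk (A i))
    (zariskiProdGL n)

end WildHecke

end

/-!
Put `R = ∏ᵢ ℂ[εᵢ]` and `y = (tᵢ + εᵢ)ᵢ`. As the `tᵢ` are distinct, `y` generates the `ℂ`-algebra
`R`, and the points `g_{s, x}` form a single curve `γ(s) = g_{y, x}(s)` in `GL₂(R)`, quadratic in
`s`.

Let a closed subgroup of `GL₂(R)` contain the scalars and all quotients `γ(s')⁻¹ γ(s)`. After a
fixed conjugation, the quotients with `s' = l s` degenerate for `s → 0` to `diag(l, 1)`, and this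
torus extracts unipotent elements from the tangents to the quotients at the diagonal `s' = s`. The
upper and the lower unipotent elements form subspaces `U` and `L` of `R` with `U U L ⊆ U` and
`L L U ⊆ L`. Since `U` contains a unit and `L` contains `z` and `z y` for a unit `z`, both are all
of `R`, and the subgroup is `GL₂(R)`.

For dominance, the Zariski closures of the sets of all `γ(s₁) ⋯ γ(s_N) u`, `u ∈ Rˣ`, in `Mat₂(R)`
are irreducible, and the one for `N + 1` contains the translates of the one for `N` by every `γ(s)`.
The codimension is at most `3 dim R` for `N = 0`, so it does not drop after some `N ≤ 3 dim R`, and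
then all these translates coincide. The stabilizer of the `N`-th closure is closed and contains the
scalars and the quotients `γ(s')⁻¹ γ(s)`, so it is `GL₂(R)`.
-/

open Filter Polynomial Topology

noncomputable section

namespace WildHecke

section FiniteAlgebra

variable {𝕜 A : Type*}

theorem finite_spectrum_of_finite [Field 𝕜] [Ring A] [Algebra 𝕜 A] [Module.Finite 𝕜 A] (a : A) :
    (spectrum 𝕜 a).Finite :=
  (Module.End.finite_spectrum (Algebra.lmul 𝕜 A a)).subset fun z hz h => hz <| by
    rwa [spectrum.mem_resolventSet_iff, ← AlgHom.commutes (Algebra.lmul 𝕜 A) z, ← map_sub,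
      Algebra.lmul_isUnit_iff] at h

theorem eventually_isUnit_add_algebraMap [Field 𝕜] [TopologicalSpace 𝕜] [T1Space 𝕜] [Ring A]
    [Algebra 𝕜 A] [Module.Finite 𝕜 A] (a : A) :
    ∀ᶠ z in 𝓝[≠] (0 : 𝕜), IsUnit (a + algebraMap 𝕜 A z) := by
  filter_upwards [self_mem_nhdsWithin, nhdsNE_le_cofinite 0
    ((finite_spectrum_of_finite (-a)).subset Set.sdiff_subset).compl_mem_cofinite] with z hz0 hz
  have : z ∉ spectrum 𝕜 (-a) := fun h => hz ⟨h, hz0⟩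
  rwa [spectrum.notMem_iff, sub_neg_eq_add, add_comm] at this

theorem exists_sq_eq_of_isUnit [Field 𝕜] [IsAlgClosed 𝕜] [NeZero (2 : 𝕜)] [CommRing A]
    [Algebra 𝕜 A] [Module.Finite 𝕜 A] {u : A} (hu : IsUnit u) : ∃ w, w ^ 2 = u := by
  have := IsArtinianRing.of_finite 𝕜 A
  have hsq : ∀ m : MaximalSpectrum A, ∃ c : A ⧸ m.asIdeal, c ^ 2 = Ideal.Quotient.mk _ u := by
    intro m
    have := m.isMaximal
    obtain ⟨z, hz⟩ := (IsAlgClosed.algebraMap_bijective_of_isIntegral (k := 𝕜)).2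
      (Ideal.Quotient.mk m.asIdeal u)
    obtain ⟨c, hc⟩ := IsAlgClosed.exists_pow_nat_eq z two_pos
    exact ⟨algebraMap 𝕜 _ c, by rw [← map_pow, hc, hz]⟩
  choose c hc using hsq
  obtain ⟨w', hw'⟩ := (IsArtinianRing.quotNilradicalEquivPi A).surjective c
  obtain ⟨w, rfl⟩ := Ideal.Quotient.mk_surjective w'
  have hnil : IsNilpotent (w ^ 2 - u) := by
    rw [← mem_nilradical, ← Ideal.Quotient.mk_eq_mk_iff_sub_mem]
    apply (IsArtinianRing.quotNilradicalEquivPi A).injective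
    rw [map_pow, map_pow, hw']
    ext m
    exact hc m
  have hw : IsUnit w := by
    have : IsUnit (w ^ 2) := by simpa using hnil.isUnit_add_left_of_commute hu (Commute.all _ _)
    exact (isUnit_pow_iff two_ne_zero).1 this
  have h2 : IsUnit (2 : A) := by
    rw [← map_ofNat (algebraMap 𝕜 A) 2]
    exact (isUnit_iff_ne_zero.2 two_ne_zero).map _
  obtain ⟨v, ⟨-, hv⟩, -⟩ := existsUnique_nilpotent_sub_and_aeval_eq_zero (P := X ^ 2 - C u)
    (x := w) (by simpa using hnil) (by simpa [one_add_one_eq_two] using And.intro h2 hw)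
  exact ⟨v, by simpa [sub_eq_zero] using hv⟩

theorem isInducing_units_val (𝕜 : Type*) [NontriviallyNormedField 𝕜] [Ring A] [Algebra 𝕜 A]
    [Module.Finite 𝕜 A] [TopologicalSpace A] [IsModuleTopology 𝕜 A] :
    IsInducing (Units.val : Aˣ → A) := by
  have := IsModuleTopology.toContinuousAdd 𝕜 A
  let b := Module.finBasis 𝕜 A
  let f (a : A) : A := b.equivFun.symm ((Algebra.leftMulMatrix b a)⁻¹.mulVec (b.equivFun 1))
  refine (Units.isEmbedding_val_mk' (f := f) (fun a ha => ContinuousAt.continuousWithinAt ?_)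
    fun u => ?_).isInducing
  · have hL : Continuous (Algebra.leftMulMatrix b) :=
      IsModuleTopology.continuous_of_linearMap (Algebra.leftMulMatrix b).toLinearMap
    have hdet : (Algebra.leftMulMatrix b a).det ≠ 0 :=
      ((Matrix.isUnit_iff_isUnit_det _).1 (ha.map _)).ne_zero
    have hinv : ContinuousAt (fun a => (Algebra.leftMulMatrix b a)⁻¹) a :=
      (continuousAt_matrix_inv _ (by
        rw [Ring.inverse_eq_inv']; exact continuousAt_inv₀ hdet)).comp hL.continuousAt
    have hg : Continuous fun M : Matrix _ _ 𝕜 => b.equivFun.symm (M.mulVec (b.equivFun 1)) :=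
      (IsModuleTopology.continuous_of_linearMap b.equivFun.symm.toLinearMap).comp
        (continuous_id.matrix_mulVec continuous_const)
    exact hg.continuousAt.comp hinv
  · have hu : (Algebra.leftMulMatrix b u)⁻¹ = Algebra.leftMulMatrix b ↑u⁻¹ :=
      Matrix.inv_eq_left_inv (by rw [← map_mul, Units.inv_mul, map_one])
    have h1 := Algebra.leftMulMatrix_mulVec_repr b (↑u⁻¹ : A) 1
    rw [mul_one] at h1
    exact b.equivFun.symm_apply_eq.2 (by rw [hu]; exact h1)

end FiniteAlgebra

section ToralSubmonoid

variable {𝕜 R : Type*} [NontriviallyNormedField 𝕜] [CommRing R] [Algebra 𝕜 R]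
  {P : Submonoid (Matrix (Fin 2) (Fin 2) R)}

local notation "κ" => algebraMap 𝕜 R

variable (𝕜) in
/-- A submonoid of the `2 × 2` matrices that contains the invertible scalars and the torus of all
`diag(l, 1)` for `l` in the ground field, and is relatively closed among invertible matrices. -/
structure IsToral [TopologicalSpace R] (P : Submonoid (Matrix (Fin 2) (Fin 2) R)) : Prop where
  scalar_mem : ∀ u, IsUnit u → !![u, 0; 0, u] ∈ P
  torus_mem : ∀ l : 𝕜, l ≠ 0 → !![κ l, 0; 0, 1] ∈ P
  mem_of_mem_closure : ∀ A ∈ closure (P : Set (Matrix (Fin 2) (Fin 2) R)), IsUnit A → A ∈ P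

theorem mem_of_unit_mul_mem (hP : ∀ u, IsUnit u → !![u, 0; 0, u] ∈ P) {u a b c d : R}
    (hu : IsUnit u) (h : !![u * a, u * b; u * c, u * d] ∈ P) : !![a, b; c, d] ∈ P := by
  obtain ⟨u, rfl⟩ := hu
  convert P.mul_mem (hP _ u⁻¹.isUnit) h using 1
  simp

/-- The submonoid of the transposes of the elements of `P`; it exchanges the roles of upper and
lower triangular matrices. -/
def transposeSubmonoid (P : Submonoid (Matrix (Fin 2) (Fin 2) R)) :
    Submonoid (Matrix (Fin 2) (Fin 2) R) where
  carrier := {A | A.transpose ∈ P}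
  one_mem' := by simp
  mul_mem' hA hB := by simpa using P.mul_mem hB hA

theorem of_mem_transposeSubmonoid {a b c d : R} :
    !![a, b; c, d] ∈ transposeSubmonoid P ↔ !![a, c; b, d] ∈ P := by
  have hT : !![a, b; c, d].transpose = !![a, c; b, d] := Matrix.eta_fin_two _
  rw [← hT]
  rfl

theorem continuous_matrix_fin_two {X M : Type*} [TopologicalSpace X] [TopologicalSpace M]
    {a b c d : X → M} (ha : Continuous a) (hb : Continuous b) (hc : Continuous c)
    (hd : Continuous d) : Continuous fun δ => !![a δ, b δ; c δ, d δ] :=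
  continuous_matrix fun i j => by fin_cases i <;> fin_cases j <;> assumption

namespace IsToral

variable [TopologicalSpace R]

theorem transpose (h : IsToral 𝕜 P) : IsToral 𝕜 (transposeSubmonoid P) where
  scalar_mem u hu := of_mem_transposeSubmonoid.2 (h.scalar_mem u hu)
  torus_mem l hl := of_mem_transposeSubmonoid.2 (h.torus_mem l hl)
  mem_of_mem_closure A hA hu := h.mem_of_mem_closure _
    (map_mem_closure (continuous_id.matrix_transpose) hA fun _ hB => hB) (by simpa using hu)

theorem conj_torus_mem (h : IsToral 𝕜 P) {l : 𝕜} (hl : l ≠ 0) {a b c d : R}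
    (hA : !![a, b; c, d] ∈ P) : !![a, κ l * b; κ l⁻¹ * c, d] ∈ P := by
  have hl' : κ l * κ l⁻¹ = 1 := by rw [← map_mul, mul_inv_cancel₀ hl, map_one]
  convert P.mul_mem (P.mul_mem (h.torus_mem l hl) hA) (h.torus_mem _ (inv_ne_zero hl)) using 1
  rw [Matrix.mul_fin_two, Matrix.mul_fin_two]
  congrm !![?_, ?_; ?_, ?_]
  · linear_combination -a * hl'
  all_goals ring

/-- The root subgroup of the upper triangular unipotent elements of `P`, as a subspace of `R`. -/
def upper (h : IsToral 𝕜 P) : Submodule 𝕜 R where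
  carrier := {q | !![1, q; 0, 1] ∈ P}
  zero_mem' := by simp [← Matrix.one_fin_two]
  add_mem' {a b} ha hb := by simpa [add_comm] using P.mul_mem ha hb
  smul_mem' l q hq := by
    by_cases hl : l = 0
    · simp [hl, ← Matrix.one_fin_two]
    · simpa [Algebra.smul_def] using h.conj_torus_mem hl hq

/-- The root subgroup of the lower triangular unipotent elements of `P`, as a subspace of `R`. -/
def lower (h : IsToral 𝕜 P) : Submodule 𝕜 R := h.transpose.upper

theorem mem_upper (h : IsToral 𝕜 P) {q : R} : q ∈ h.upper ↔ !![1, q; 0, 1] ∈ P := Iff.rfl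

theorem mem_lower (h : IsToral 𝕜 P) {r : R} : r ∈ h.lower ↔ !![1, 0; r, 1] ∈ P :=
  of_mem_transposeSubmonoid

theorem mem_lower_transpose (h : IsToral 𝕜 P) {q : R} : q ∈ h.transpose.lower ↔ q ∈ h.upper := by
  rw [mem_lower, of_mem_transposeSubmonoid, mem_upper]

section Jordan

variable [IsTopologicalRing R] [ContinuousSMul 𝕜 R]

-- Conjugating by `diag(δ⁻¹, 1)` blows up the tangent direction of a curve through a scalar matrix.
theorem mem_upper_of_eventually (h : IsToral 𝕜 P) {a b c d : 𝕜 → R} (ha : Continuous a)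
    (hb : Continuous b) (hc : Continuous c) (hd : Continuous d) (had : d 0 = a 0)
    (hu : IsUnit (a 0)) {q : R} (hq : a 0 * q = b 0)
    (hP : ∀ᶠ δ in 𝓝[≠] 0, !![a δ, κ δ * b δ; κ δ * c δ, d δ] ∈ P) : q ∈ h.upper := by
  have : Continuous κ := continuous_algebraMap 𝕜 R
  have hlim : Tendsto (fun δ => !![a δ, b δ; κ δ ^ 2 * c δ, d δ]) (𝓝[≠] 0)
      (𝓝 !![a 0, b 0; 0, a 0]) := by
    have hcont : Continuous fun δ => !![a δ, b δ; κ δ ^ 2 * c δ, d δ] :=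
      continuous_matrix_fin_two ha hb (by fun_prop) hd
    simpa [had] using (hcont.tendsto 0).mono_left nhdsWithin_le_nhds
  have hmem : !![a 0, b 0; 0, a 0] ∈ P := by
    have hunit : IsUnit !![a 0, b 0; 0, a 0] := by
      rw [Matrix.isUnit_iff_isUnit_det, Matrix.det_fin_two_of]
      simpa using hu.mul hu
    refine h.mem_of_mem_closure _ (mem_closure_of_tendsto hlim ?_) hunit
    filter_upwards [hP, self_mem_nhdsWithin] with δ hδ hδ0
    have hinv : κ δ⁻¹ * κ δ = 1 := by rw [← map_mul, inv_mul_cancel₀ hδ0, map_one]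
    refine SetLike.mem_coe.2 ?_
    convert h.conj_torus_mem (inv_ne_zero hδ0) hδ using 1
    rw [inv_inv, ← mul_assoc, hinv, one_mul, ← mul_assoc, sq]
  exact h.mem_upper.2 (mem_of_unit_mul_mem h.scalar_mem hu (by simpa [hq] using hmem))

theorem sq_mul_mem_upper (h : IsToral 𝕜 P) {q r : R} (hq : q ∈ h.upper) (hr : r ∈ h.lower) :
    q ^ 2 * r ∈ h.upper := by
  have : Continuous κ := continuous_algebraMap 𝕜 R
  refine neg_mem_iff.1 (h.mem_upper_of_eventually (a := fun δ => 1 - κ δ * (q * r))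
    (b := fun _ => -(q ^ 2 * r)) (c := fun _ => r) (d := fun δ => 1 + κ δ * (q * r))
    (by fun_prop) (by fun_prop) (by fun_prop) (by fun_prop) (by simp) (by simp) (by simp)
    (.of_forall fun δ => ?_))
  have hδ : κ δ * r ∈ h.lower := by simpa [Algebra.smul_def] using h.lower.smul_mem δ hr
  convert P.mul_mem (P.mul_mem (h.mem_upper.1 (neg_mem hq)) (h.mem_lower.1 hδ)) hq using 1
  rw [Matrix.mul_fin_two, Matrix.mul_fin_two]
  congrm !![?_, ?_; ?_, ?_] <;> ring

variable [NeZero (2 : 𝕜)]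

theorem mul_mul_mem_upper (h : IsToral 𝕜 P) {q q' r : R} (hq : q ∈ h.upper) (hq' : q' ∈ h.upper)
    (hr : r ∈ h.lower) : q * q' * r ∈ h.upper := by
  have hpol : (2 : 𝕜) • (q * q' * r) = (q + q') ^ 2 * r - q ^ 2 * r - q' ^ 2 * r := by
    rw [two_smul]; ring
  rw [← h.upper.smul_mem_iff (two_ne_zero (α := 𝕜)), hpol]
  exact sub_mem (sub_mem (h.sq_mul_mem_upper (add_mem hq hq') hr) (h.sq_mul_mem_upper hq hr))
    (h.sq_mul_mem_upper hq' hr)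

theorem mul_mul_mem_lower (h : IsToral 𝕜 P) {r r' q : R} (hr : r ∈ h.lower) (hr' : r' ∈ h.lower)
    (hq : q ∈ h.upper) : r * r' * q ∈ h.lower :=
  h.transpose.mul_mul_mem_upper hr hr' (h.mem_lower_transpose.2 hq)

theorem upper_eq_top [Module.Finite 𝕜 R] (h : IsToral 𝕜 P) {y e z : R}
    (hy : Algebra.adjoin 𝕜 {y} = ⊤) (he : e ∈ h.upper) (heu : IsUnit e) (hz : z ∈ h.lower)
    (hzu : IsUnit z) (hzy : z * y ∈ h.lower) : h.upper = ⊤ := by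
  have hact {r q : R} (hr : r ∈ h.lower) (hq : q ∈ h.upper) : e * r * q ∈ h.upper := by
    rw [mul_right_comm]; exact h.mul_mul_mem_upper he hq hr
  have hinj : Function.Injective (LinearMap.mulLeft 𝕜 (e * z)) := (heu.mul hzu).mul_right_injective
  have hmap : h.upper.map (LinearMap.mulLeft 𝕜 (e * z)) = h.upper :=
    Submodule.eq_of_le_of_finrank_eq (by rintro _ ⟨q, hq, rfl⟩; exact hact hz hq)
      (Submodule.equivMapOfInjective _ hinj h.upper).finrank_eq.symm
  have hmul_y : ∀ q ∈ h.upper, y * q ∈ h.upper := fun q hq => by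
    rw [← hmap] at hq
    obtain ⟨q, hq, rfl⟩ := hq
    rw [LinearMap.mulLeft_apply, show y * (e * z * q) = e * (z * y) * q by ring]
    exact hact hzy hq
  have hmul : ∀ a : R, ∀ q ∈ h.upper, a * q ∈ h.upper := fun a => by
    have ha : a ∈ Algebra.adjoin 𝕜 {y} := hy ▸ Algebra.mem_top
    induction ha using Algebra.adjoin_induction with
    | mem a ha => rwa [Set.mem_singleton_iff.1 ha]
    | algebraMap c => exact fun q hq => by rw [← Algebra.smul_def]; exact h.upper.smul_mem c hq
    | add a b _ _ ha hb => exact fun q hq => by rw [add_mul]; exact add_mem (ha q hq) (hb q hq)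
    | mul a b _ _ ha hb => exact fun q hq => by rw [mul_assoc]; exact ha _ (hb q hq)
  obtain ⟨u, rfl⟩ := heu
  exact eq_top_iff.2 fun a _ => by simpa using hmul (a * ↑u⁻¹) _ he

theorem lower_eq_top (h : IsToral 𝕜 P) {z : R} (hU : h.upper = ⊤) (hz : z ∈ h.lower)
    (hzu : IsUnit z) : h.lower = ⊤ := by
  obtain ⟨u, rfl⟩ := hzu
  refine eq_top_iff.2 fun a _ => ?_
  have hq : (↑u⁻¹ * ↑u⁻¹ * a : R) ∈ h.upper := hU ▸ Submodule.mem_top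
  convert h.mul_mul_mem_lower hz hz hq using 1
  linear_combination -a * (1 + ↑u * ↑u⁻¹) * u.mul_inv

end Jordan

section Generation

theorem diag_inv_mem (h : IsToral 𝕜 P) (hU : h.upper = ⊤) (hL : h.lower = ⊤) {a b : R}
    (hab : a * b = 1) : !![a, 0; 0, b] ∈ P := by
  have hu (q : R) : !![1, q; 0, 1] ∈ P := h.mem_upper.1 (hU ▸ Submodule.mem_top)
  have hl (r : R) : !![1, 0; r, 1] ∈ P := h.mem_lower.1 (hL ▸ Submodule.mem_top)
  convert P.mul_mem (P.mul_mem (P.mul_mem (P.mul_mem (P.mul_mem (hu a) (hl (-b))) (hu a))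
    (hu (-1))) (hl 1)) (hu (-1)) using 1
  simp only [Matrix.mul_fin_two]
  congrm !![?_, ?_; ?_, ?_]
  · linear_combination a * hab
  · linear_combination -hab
  · linear_combination hab
  · ring

variable [IsAlgClosed 𝕜] [NeZero (2 : 𝕜)] [Module.Finite 𝕜 R]

theorem diag_mem (h : IsToral 𝕜 P) (hU : h.upper = ⊤) (hL : h.lower = ⊤) {a d : R}
    (ha : IsUnit a) (hd : IsUnit d) : !![a, 0; 0, d] ∈ P := by
  obtain ⟨w, hw⟩ := exists_sq_eq_of_isUnit (𝕜 := 𝕜) (ha.mul hd)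
  obtain ⟨w, rfl⟩ : IsUnit w := (isUnit_pow_iff two_ne_zero).1 (hw ▸ ha.mul hd)
  have hdet : (↑w⁻¹ * a) * (↑w⁻¹ * d) = 1 := by
    rw [mul_mul_mul_comm, ← hw, ← sq, ← mul_pow, w.inv_mul, one_pow]
  convert P.mul_mem (h.scalar_mem _ w.isUnit) (h.diag_inv_mem hU hL hdet) using 1
  simp

theorem mem_of_isUnit_apply_zero (h : IsToral 𝕜 P) (hU : h.upper = ⊤) (hL : h.lower = ⊤)
    {A : Matrix (Fin 2) (Fin 2) R} (hA : IsUnit A) (h00 : IsUnit (A 0 0)) : A ∈ P := by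
  rw [Matrix.isUnit_iff_isUnit_det, Matrix.det_fin_two] at hA
  rw [Matrix.eta_fin_two A]
  obtain ⟨u, hu⟩ := h00
  have hu' := u.mul_inv
  have hd : IsUnit (A 1 1 - A 1 0 * ↑u⁻¹ * A 0 1) := by
    rw [← Units.isUnit_units_mul u]
    convert hA using 1
    rw [← hu]
    linear_combination -(A 1 0 * A 0 1) * hu'
  convert P.mul_mem (P.mul_mem (h.mem_lower.1 (hL ▸ Submodule.mem_top : A 1 0 * ↑u⁻¹ ∈ h.lower))
    (h.diag_mem hU hL u.isUnit hd))
    (h.mem_upper.1 (hU ▸ Submodule.mem_top : ↑u⁻¹ * A 0 1 ∈ h.upper)) using 1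
  rw [Matrix.mul_fin_two, Matrix.mul_fin_two, ← hu]
  congrm !![?_, ?_; ?_, ?_]
  · ring
  · linear_combination -A 0 1 * hu'
  · linear_combination -A 1 0 * hu'
  · linear_combination -(A 1 0 * A 0 1 * ↑u⁻¹) * hu'

theorem mem_of_isUnit [IsTopologicalRing R] [ContinuousSMul 𝕜 R] (h : IsToral 𝕜 P)
    (hU : h.upper = ⊤) (hL : h.lower = ⊤) {A : Matrix (Fin 2) (Fin 2) R} (hA : IsUnit A) :
    A ∈ P := by
  have hcont : Continuous fun δ : 𝕜 => A + algebraMap 𝕜 _ δ :=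
    continuous_const.add (continuous_algebraMap 𝕜 _)
  have hlim := (hcont.tendsto 0).mono_left (nhdsWithin_le_nhds (s := {0}ᶜ))
  rw [map_zero, add_zero] at hlim
  refine h.mem_of_mem_closure _ (mem_closure_of_tendsto hlim ?_) hA
  filter_upwards [eventually_isUnit_add_algebraMap (𝕜 := 𝕜) A,
    eventually_isUnit_add_algebraMap (𝕜 := 𝕜) (A 0 0)] with δ hδ hδ00
  exact h.mem_of_isUnit_apply_zero hU hL hδ (by simpa [Matrix.algebraMap_matrix_apply] using hδ00)

end Generation

end IsToral

end ToralSubmonoid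

section Curve

variable {𝕜 R : Type*} [CommRing R]

/-- The matrix `g_{y, x}(s)`, over an arbitrary commutative ring. -/
def curveMatrix (x y s : R) : Matrix (Fin 2) (Fin 2) R :=
  !![-(s - 1) * x, y * (s * (s - 1)); -(s - x), s * (s - x)]

/-- A right translate of `curveMatrix x y`, so that the left quotients of the two curves are
conjugate. The translation is chosen to make the leading coefficients of these quotients, both at
the origin and along the diagonal, triangular. -/
def normalizedCurve (x y s : R) : Matrix (Fin 2) (Fin 2) R :=
  curveMatrix x y s * !![y - x, 0; 1 - x, 1]

theorem adjugate_normalizedCurve_mul (x y s s' : R) :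
    (normalizedCurve x y s').adjugate * normalizedCurve x y s =
      !![s' * (y * (1 - s') * (x - s) * (y - x - (1 - x) * s)
            - (x - s') * (1 - s) * (x * (y - x) - (1 - x) * y * s)),
          (1 - x) * y * s * s' * (s - s');
        (1 - x) * (y - 1) * (s' - s) * (x * (y - x) * (s + s') - (y - x ^ 2) * s * s'),
          s * (y * (x - s') * (1 - s) * (y - x - (1 - x) * s')
            - (1 - s') * (x - s) * (x * (y - x) - (1 - x) * y * s'))] := by
  rw [normalizedCurve, normalizedCurve, curveMatrix, curveMatrix, Matrix.mul_fin_two,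
    Matrix.mul_fin_two, Matrix.adjugate_fin_two_of, Matrix.mul_fin_two]
  congrm !![?_, ?_; ?_, ?_] <;> ring

variable [NontriviallyNormedField 𝕜] [Algebra 𝕜 R]

local notation "κ" => algebraMap 𝕜 R

/-- The submonoid `P` contains the quotients `k(s')⁻¹ k(s)`, up to determinants, of any two points
of `normalizedCurve x y`. -/
def ContainsCurveQuotients (P : Submonoid (Matrix (Fin 2) (Fin 2) R)) (x : 𝕜) (y : R) : Prop :=
  ∀ s ∉ ({0, 1, x} : Set 𝕜), ∀ s' ∉ ({0, 1, x} : Set 𝕜),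
    (normalizedCurve (κ x) y (κ s')).adjugate * normalizedCurve (κ x) y (κ s) ∈ P

theorem eventually_add_mul_notMem {S : Set 𝕜} (hS : S.Finite) (s : 𝕜) {l : 𝕜} (hl : l ≠ 0) :
    ∀ᶠ δ in 𝓝[≠] (0 : 𝕜), s + l * δ ∉ S :=
  nhdsNE_le_cofinite 0 (hS.preimage
    ((add_right_injective s).comp (mul_right_injective₀ hl)).injOn).compl_mem_cofinite

variable [TopologicalSpace R] [IsTopologicalRing R] [ContinuousSMul 𝕜 R]
  {P : Submonoid (Matrix (Fin 2) (Fin 2) R)} {x : 𝕜} {y : R}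

theorem ContainsCurveQuotients.torus_mem (hP : ContainsCurveQuotients P x y)
    (hscalar : ∀ u, IsUnit u → !![u, 0; 0, u] ∈ P)
    (hclosure : ∀ A ∈ closure (P : Set (Matrix (Fin 2) (Fin 2) R)), IsUnit A → A ∈ P)
    (hx : x ≠ 0) (hy : IsUnit (y - κ x)) {l : 𝕜} (hl : l ≠ 0) : !![κ l, 0; 0, 1] ∈ P := by
  have : Continuous κ := continuous_algebraMap 𝕜 R
  let F (δ : 𝕜) : Matrix (Fin 2) (Fin 2) R :=
    !![κ l * (y * (1 - κ l * κ δ) * (κ x - κ δ) * (y - κ x - (1 - κ x) * κ δ)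
        - (κ x - κ l * κ δ) * (1 - κ δ) * (κ x * (y - κ x) - (1 - κ x) * y * κ δ)),
      (1 - κ x) * y * κ δ * κ l * (κ δ - κ l * κ δ);
      (1 - κ x) * (y - 1) * (κ l - 1)
        * (κ x * (y - κ x) * (κ δ + κ l * κ δ) - (y - κ x ^ 2) * κ δ * (κ l * κ δ)),
      y * (κ x - κ l * κ δ) * (1 - κ δ) * (y - κ x - (1 - κ x) * (κ l * κ δ))
        - (1 - κ l * κ δ) * (κ x - κ δ) * (κ x * (y - κ x) - (1 - κ x) * y * (κ l * κ δ))]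
  have hF : Continuous F :=
    continuous_matrix_fin_two (by fun_prop) (by fun_prop) (by fun_prop) (by fun_prop)
  have hF0 : F 0 = !![κ x * (y - κ x) ^ 2 * κ l, κ x * (y - κ x) ^ 2 * 0;
      κ x * (y - κ x) ^ 2 * 0, κ x * (y - κ x) ^ 2 * 1] := by
    simp only [F, mul_zero, map_zero]
    congrm !![?_, ?_; ?_, ?_] <;> ring
  have hu : IsUnit (κ x * (y - κ x) ^ 2) := (hx.isUnit.map κ).mul (hy.pow 2)
  refine mem_of_unit_mul_mem hscalar hu (hF0 ▸ hclosure _ (mem_closure_of_tendsto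
    ((hF.tendsto 0).mono_left (nhdsWithin_le_nhds (s := {0}ᶜ))) ?_) ?_)
  · filter_upwards [self_mem_nhdsWithin, eventually_add_mul_notMem (Set.toFinite {0, 1, x}) 0
      one_ne_zero, eventually_add_mul_notMem (Set.toFinite {0, 1, x}) 0 hl] with δ hδ hδ1 hδl
    rw [zero_add, one_mul] at hδ1
    rw [zero_add] at hδl
    refine mem_of_unit_mul_mem hscalar (IsUnit.map κ (Ne.isUnit hδ)) ?_
    convert hP δ hδ1 (l * δ) hδl using 1
    rw [adjugate_normalizedCurve_mul, map_mul]
    congrm !![?_, ?_; ?_, ?_] <;> ring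
  · rw [hF0, Matrix.isUnit_iff_isUnit_det, Matrix.det_fin_two_of]
    simpa using (hu.mul (hl.isUnit.map κ)).mul hu

theorem ContainsCurveQuotients.exists_tangent (hP : ContainsCurveQuotients P x y) {s : 𝕜}
    (hs : s ∉ ({0, 1, x} : Set 𝕜)) : ∃ a b c d : 𝕜 → R,
      Continuous a ∧ Continuous b ∧ Continuous c ∧ Continuous d ∧
      a 0 = κ (s * (1 - s) * (x - s)) * (y - κ x) ^ 2 ∧ d 0 = a 0 ∧
      b 0 = κ ((1 - x) * s * s) * y ∧
      c 0 = κ ((x - 1) * s) * ((y - 1) * (2 * κ x * (y - κ x) - (y - κ x ^ 2) * κ s)) ∧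
      ∀ᶠ δ in 𝓝[≠] 0, !![a δ, κ δ * b δ; κ δ * c δ, d δ] ∈ P := by
  have : Continuous κ := continuous_algebraMap 𝕜 R
  refine ⟨fun δ => κ s * (y * (1 - κ s) * (κ x - (κ s + κ δ)) * (y - κ x - (1 - κ x) * (κ s + κ δ))
      - (κ x - κ s) * (1 - (κ s + κ δ)) * (κ x * (y - κ x) - (1 - κ x) * y * (κ s + κ δ))),
    fun δ => (1 - κ x) * y * (κ s + κ δ) * κ s,
    fun δ => (κ x - 1) * (y - 1)
      * (κ x * (y - κ x) * (κ s + κ δ + κ s) - (y - κ x ^ 2) * (κ s + κ δ) * κ s),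
    fun δ => (κ s + κ δ) * (y * (κ x - κ s) * (1 - (κ s + κ δ)) * (y - κ x - (1 - κ x) * κ s)
      - (1 - κ s) * (κ x - (κ s + κ δ)) * (κ x * (y - κ x) - (1 - κ x) * y * κ s)),
    by fun_prop, by fun_prop, by fun_prop, by fun_prop, ?_, ?_, ?_, ?_, ?_⟩
  iterate 4
    simp only [map_mul, map_sub, map_one, map_zero]
    ring
  filter_upwards [eventually_add_mul_notMem (Set.toFinite {0, 1, x}) s one_ne_zero] with δ hδ
  rw [one_mul] at hδ
  convert hP _ hδ _ hs using 1
  rw [adjugate_normalizedCurve_mul, map_add]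
  congrm !![?_, ?_; ?_, ?_] <;> ring

namespace IsToral

variable {w : R} {s : 𝕜}

theorem mul_mem_of_curve (h : IsToral 𝕜 P) (hP : ContainsCurveQuotients P x y) (hx1 : x ≠ 1)
    (hw : (y - κ x) ^ 2 * w = 1) (hs : s ∉ ({0, 1, x} : Set 𝕜)) :
    y * w ∈ h.upper ∧
      (y - 1) * (2 * κ x * (y - κ x) - (y - κ x ^ 2) * κ s) * w ∈ h.lower := by
  obtain ⟨a, b, c, d, ha, hb, hc, hd, ha0, hd0, hb0, hc0, hmem⟩ := hP.exists_tangent hs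
  obtain ⟨hs0, hs1, hsx⟩ : s ≠ 0 ∧ s ≠ 1 ∧ s ≠ x := by simpa using hs
  have hx1' : x - 1 ≠ 0 := sub_ne_zero.2 hx1
  have hs1' : 1 - s ≠ 0 := sub_ne_zero.2 hs1.symm
  have hsx' : x - s ≠ 0 := sub_ne_zero.2 hsx.symm
  have hu : IsUnit (a 0) := ha0 ▸ ((mul_ne_zero (mul_ne_zero hs0 hs1') hsx').isUnit.map κ).mul
    (IsUnit.of_mul_eq_one _ hw)
  let z : 𝕜 := (x - 1) / ((1 - s) * (x - s))
  have hz : z ≠ 0 := div_ne_zero hx1' (mul_ne_zero hs1' hsx')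
  have hz' : s * (1 - s) * (x - s) * z = (x - 1) * s := by
    simp only [z]; field_simp
  constructor
  · rw [← h.upper.smul_mem_iff (mul_ne_zero (neg_ne_zero.2 hz) hs0)]
    refine h.mem_upper_of_eventually ha hb hc hd hd0 hu ?_ hmem
    rw [ha0, hb0, Algebra.smul_def]
    calc _ = κ (s * (1 - s) * (x - s) * z * -s) * y * ((y - κ x) ^ 2 * w) := by
          simp only [map_mul, map_neg]; ring
      _ = _ := by rw [hz', hw, mul_one]; congr 2; ring
  · rw [← h.lower.smul_mem_iff hz]
    refine h.transpose.mem_upper_of_eventually ha hc hb hd hd0 hu ?_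
      (hmem.mono fun δ hδ => of_mem_transposeSubmonoid.2 hδ)
    rw [ha0, hc0, Algebra.smul_def]
    calc _ = κ (s * (1 - s) * (x - s) * z)
          * ((y - 1) * (2 * κ x * (y - κ x) - (y - κ x ^ 2) * κ s)) * ((y - κ x) ^ 2 * w) := by
          simp only [map_mul]; ring
      _ = _ := by rw [hz', hw, mul_one]

theorem mul_mem_lower_of_curve (h : IsToral 𝕜 P) (hP : ContainsCurveQuotients P x y)
    [NeZero (2 : 𝕜)] (hx0 : x ≠ 0) (hx1 : x ≠ 1) (hw : (y - κ x) ^ 2 * w = 1) :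
    (y - 1) * w ∈ h.lower ∧ (y - 1) * w * y ∈ h.lower := by
  obtain ⟨s, hs⟩ := (Set.toFinite ({0, 1, x} : Set 𝕜)).infinite_compl.nonempty
  obtain ⟨s', hs'⟩ := (Set.toFinite ({0, 1, x, s} : Set 𝕜)).infinite_compl.nonempty
  obtain ⟨hs'1, hss'⟩ : s' ∉ ({0, 1, x} : Set 𝕜) ∧ s - s' ≠ 0 := by
    simp only [Set.mem_compl_iff, Set.mem_insert_iff, Set.mem_singleton_iff, not_or] at hs' ⊢
    exact ⟨⟨hs'.1, hs'.2.1, hs'.2.2.1⟩, sub_ne_zero.2 (Ne.symm hs'.2.2.2)⟩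
  have hm := (h.mul_mem_of_curve hP hx1 hw hs).2
  have hm' := (h.mul_mem_of_curve hP hx1 hw hs'1).2
  have h1 : (y - 1) * (y - κ x ^ 2) * w ∈ h.lower := by
    rw [← h.lower.smul_mem_iff hss']
    convert sub_mem hm' hm using 1
    rw [Algebra.smul_def, map_sub]
    ring
  have h2 : (y - 1) * (y - κ x) * w ∈ h.lower := by
    rw [← h.lower.smul_mem_iff (mul_ne_zero two_ne_zero hx0)]
    convert add_mem hm (h.lower.smul_mem s h1) using 1
    rw [Algebra.smul_def, Algebra.smul_def, map_mul, map_ofNat]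
    ring
  have h3 : (y - 1) * w ∈ h.lower := by
    rw [← h.lower.smul_mem_iff (mul_ne_zero hx0 (sub_ne_zero.2 hx1))]
    convert sub_mem h2 h1 using 1
    rw [Algebra.smul_def, map_mul, map_sub, map_one]
    ring
  refine ⟨h3, ?_⟩
  convert add_mem h2 (h.lower.smul_mem x h3) using 1
  rw [Algebra.smul_def]
  ring

end IsToral

section

variable [IsAlgClosed 𝕜] [NeZero (2 : 𝕜)] [Module.Finite 𝕜 R]

theorem mem_of_containsCurveQuotients (hP : ContainsCurveQuotients P x y)
    (hscalar : ∀ u, IsUnit u → !![u, 0; 0, u] ∈ P)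
    (hclosure : ∀ A ∈ closure (P : Set (Matrix (Fin 2) (Fin 2) R)), IsUnit A → A ∈ P)
    (hx0 : x ≠ 0) (hx1 : x ≠ 1) (hadj : Algebra.adjoin 𝕜 {y} = ⊤) (hy0 : IsUnit y)
    (hy1 : IsUnit (y - 1)) (hyx : IsUnit (y - κ x)) {A : Matrix (Fin 2) (Fin 2) R}
    (hA : IsUnit A) : A ∈ P := by
  have h : IsToral 𝕜 P :=
    ⟨hscalar, fun _ hl => hP.torus_mem hscalar hclosure hx0 hyx hl, hclosure⟩
  obtain ⟨w, hw⟩ := (hyx.pow 2).exists_right_inv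
  have hwu : IsUnit w := IsUnit.of_mul_eq_one_right _ hw
  obtain ⟨s, hs⟩ := (Set.toFinite ({0, 1, x} : Set 𝕜)).infinite_compl.nonempty
  have hup := (h.mul_mem_of_curve hP hx1 hw hs).1
  obtain ⟨hz, hzy⟩ := h.mul_mem_lower_of_curve hP hx0 hx1 hw
  have hU := h.upper_eq_top hadj hup (hy0.mul hwu) hz (hy1.mul hwu) hzy
  exact h.mem_of_isUnit hU (h.lower_eq_top hU hz (hy1.mul hwu)) hA

end

end Curve

section ClosedSubgroup

variable {𝕜 R : Type*} [NontriviallyNormedField 𝕜] [CommRing R] [Algebra 𝕜 R]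

local notation "κ" => algebraMap 𝕜 R

variable (𝕜) in
theorem mem_of_coe_mem_closure {A : Type*} [Ring A] [Algebra 𝕜 A] [Module.Finite 𝕜 A]
    [TopologicalSpace A] [IsModuleTopology 𝕜 A] {K : Subgroup Aˣ} (hK : IsClosed (K : Set Aˣ))
    {u : Aˣ} (hu : (u : A) ∈ closure (K.toSubmonoid.map (Units.coeHom A) : Set A)) : u ∈ K := by
  rw [← SetLike.mem_coe, ← hK.closure_eq,
    (isInducing_units_val (A := A) 𝕜).closure_eq_preimage_closure_image]
  exact hu

theorem isUnit_det_curveMatrix {x s : 𝕜} {y : R} (hyx : IsUnit (y - κ x))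
    (hs : s ∉ ({0, 1, x} : Set 𝕜)) : IsUnit (curveMatrix (κ x) y (κ s)).det := by
  obtain ⟨hs0, hs1, hsx⟩ : s ≠ 0 ∧ s ≠ 1 ∧ s ≠ x := by simpa using hs
  have hdet : (curveMatrix (κ x) y (κ s)).det = κ (s * (s - 1) * (s - x)) * (y - κ x) := by
    simp only [curveMatrix, Matrix.det_fin_two_of, map_mul, map_sub, map_one]
    ring
  rw [hdet]
  exact ((mul_ne_zero (mul_ne_zero hs0 (sub_ne_zero.2 hs1)) (sub_ne_zero.2 hsx)).isUnit.map κ).mul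
    hyx

theorem adjugate_coe_eq (k : GL (Fin 2) R) : (k : Matrix (Fin 2) (Fin 2) R).adjugate =
    (Matrix.GeneralLinearGroup.scalar (Fin 2) k.det * k⁻¹ : GL (Fin 2) R) := by
  rw [← k.isUnit.mul_left_inj, Matrix.adjugate_mul, ← Units.val_mul, inv_mul_cancel_right,
    Matrix.GeneralLinearGroup.coe_scalar, Matrix.smul_one_eq_diagonal]
  rfl

variable [Module.Finite 𝕜 R] [TopologicalSpace R] [IsModuleTopology 𝕜 R]
  [IsAlgClosed 𝕜] [NeZero (2 : 𝕜)]

theorem eq_top_of_curve_quotients_mem {K : Subgroup (GL (Fin 2) R)}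
    (hK : IsClosed (K : Set (GL (Fin 2) R)))
    (hscalar : ∀ u, Matrix.GeneralLinearGroup.scalar (Fin 2) u ∈ K) {x : 𝕜} (hx0 : x ≠ 0)
    (hx1 : x ≠ 1) {y : R} (hadj : Algebra.adjoin 𝕜 {y} = ⊤) (hy0 : IsUnit y)
    (hy1 : IsUnit (y - 1)) (hyx : IsUnit (y - κ x))
    (hcurve : ∀ s ∉ ({0, 1, x} : Set 𝕜), ∀ s' ∉ ({0, 1, x} : Set 𝕜), ∀ γ γ' : GL (Fin 2) R,
      γ.val = curveMatrix (κ x) y (κ s) → γ'.val = curveMatrix (κ x) y (κ s') → γ'⁻¹ * γ ∈ K) :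
    K = ⊤ := by
  have := IsModuleTopology.isTopologicalRing 𝕜 R
  have hdet : IsUnit !![y - κ x, 0; 1 - κ x, 1].det := by simpa using hyx
  let h : GL (Fin 2) R := Matrix.GeneralLinearGroup.mk'' _ hdet
  let K' : Subgroup (GL (Fin 2) R) := K.comap (MulAut.conj h).toMonoidHom
  have hK' : IsClosed (K' : Set (GL (Fin 2) R)) :=
    hK.preimage ((continuous_const.mul continuous_id).mul continuous_const)
  have hscalar' (u) : Matrix.GeneralLinearGroup.scalar (Fin 2) u ∈ K' := by
    change h * _ * h⁻¹ ∈ K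
    rw [← Matrix.GeneralLinearGroup.scalar_commute, mul_inv_cancel_right]
    exact hscalar u
  have hP : ContainsCurveQuotients (K'.toSubmonoid.map (Units.coeHom _)) x y := by
    intro s hs s' hs'
    let γ := Matrix.GeneralLinearGroup.mk'' _ (isUnit_det_curveMatrix hyx hs)
    let γ' := Matrix.GeneralLinearGroup.mk'' _ (isUnit_det_curveMatrix hyx hs')
    refine ⟨_, K'.mul_mem (hscalar' (γ' * h).det) (?_ : (γ' * h)⁻¹ * (γ * h) ∈ K'), ?_⟩
    · change h * _ * h⁻¹ ∈ K
      convert hcurve s hs s' hs' γ γ' rfl rfl using 1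
      group
    · rw [← mul_assoc]
      exact congr_arg (· * (γ * h).val) (adjugate_coe_eq (γ' * h)).symm
  have : IsModuleTopology 𝕜 (Matrix (Fin 2) (Fin 2) R) :=
    inferInstanceAs (IsModuleTopology 𝕜 (Fin 2 → Fin 2 → R))
  refine (Subgroup.eq_top_iff' K).2 fun g => ?_
  have hg := mem_of_containsCurveQuotients hP (fun u hu => ⟨_, hscalar' hu.unit, ?_⟩) ?_ hx0 hx1
    hadj hy0 hy1 hyx (h⁻¹ * g * h).isUnit
  · have hg' : h⁻¹ * g * h ∈ K' := (Submonoid.mem_map_iff_mem Units.val_injective).1 hg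
    simpa [K', mul_assoc] using hg'
  · ext i j; fin_cases i <;> fin_cases j <;> simp [Matrix.GeneralLinearGroup.coe_scalar]
  · rintro _ hA ⟨u, rfl⟩
    exact Submonoid.mem_map_of_mem (Units.coeHom _) (mem_of_coe_mem_closure 𝕜 hK' hA)

end ClosedSubgroup

section LinearPullback

open MvPolynomial

variable {K σ τ υ : Type*} [Field K] [Fintype τ] [Fintype υ]

/-- The pullback of polynomial functions along the linear map `v ↦ M *ᵥ v` of affine spaces. -/
def linearPullback (M : Matrix σ τ K) : MvPolynomial σ K →ₐ[K] MvPolynomial τ K :=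
  bind₁ M.toMvPolynomial

theorem aeval_linearPullback (M : Matrix σ τ K) (v : τ → K) (p : MvPolynomial σ K) :
    aeval v (linearPullback M p) = aeval (M.mulVec v) p := by
  rw [linearPullback, aeval_bind₁]
  simp only [aeval_eq_eval, Matrix.toMvPolynomial_eval_eq_apply]

theorem linearPullback_one [Fintype σ] [DecidableEq σ] :
    linearPullback (1 : Matrix σ σ K) = AlgHom.id K _ := by
  rw [linearPullback, Matrix.toMvPolynomial_one, bind₁_X_left]

theorem linearPullback_mul (M : Matrix σ τ K) (N : Matrix τ υ K) :
    linearPullback (M * N) = (linearPullback N).comp (linearPullback M) := by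
  ext i : 1
  simp [linearPullback, Matrix.toMvPolynomial_mul]

theorem comap_linearPullback_mul (M : Matrix σ τ K) (N : Matrix τ υ K)
    (J : Ideal (MvPolynomial υ K)) :
    J.comap (linearPullback (M * N)) = (J.comap (linearPullback N)).comap (linearPullback M) := by
  rw [linearPullback_mul]
  rfl

theorem height_comap_linearPullback [Fintype σ] [DecidableEq σ] {M : Matrix σ σ K} (hM : IsUnit M)
    (J : Ideal (MvPolynomial σ K)) : (J.comap (linearPullback M)).height = J.height := by
  obtain ⟨u, rfl⟩ := hM
  let e : MvPolynomial σ K ≃ₐ[K] MvPolynomial σ K :=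
    AlgEquiv.ofAlgHom (linearPullback (u : Matrix σ σ K)) (linearPullback (↑u⁻¹ : Matrix σ σ K))
      (by rw [← linearPullback_mul, u.inv_mul, linearPullback_one])
      (by rw [← linearPullback_mul, u.mul_inv, linearPullback_one])
  exact e.toRingEquiv.height_comap J

theorem vanishingIdeal_mulVec_image (M : Matrix σ τ K) (S : Set (τ → K)) :
    vanishingIdeal K (M.mulVec '' S) = (vanishingIdeal K S).comap (linearPullback M) := by
  ext p
  simp only [Ideal.mem_comap, mem_vanishingIdeal_iff, Set.forall_mem_image, aeval_linearPullback]

theorem height_add_ringKrullDim_quotient_le {R : Type*} [CommRing R] (I : Ideal R)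
    [hI : I.IsPrime] : I.height + ringKrullDim (R ⧸ I) ≤ ringKrullDim R := by
  have : Nonempty (PrimeSpectrum R) := ⟨⟨I, hI⟩⟩
  have hIci : PrimeSpectrum.zeroLocus (I : Set R) = Set.Ici ⟨I, hI⟩ := rfl
  rw [ringKrullDim_quotient, hIci, ← Order.coheight_eq_krullDim_Ici, ringKrullDim,
    Order.krullDim_eq_iSup_height_add_coheight_of_nonempty, ← WithBot.coe_add, WithBot.coe_le_coe,
    show I.height = _ from PrimeSpectrum.height_eq_orderHeight ⟨I, hI⟩]
  exact le_iSup (fun p : PrimeSpectrum R => Order.height p + Order.coheight p) _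

theorem height_ker_linearPullback_add_card_le [Fintype σ] [DecidableEq τ] {L : Matrix σ τ K}
    {L' : Matrix τ σ K} (h : L' * L = 1) :
    (RingHom.ker (linearPullback L)).height + Fintype.card τ ≤ Fintype.card σ := by
  have hsurj : Function.Surjective (linearPullback L).toRingHom := fun p =>
    ⟨linearPullback L' p, DFunLike.congr_fun
      (by rw [← linearPullback_mul, h, linearPullback_one] :
        (linearPullback L).comp (linearPullback L') = AlgHom.id K _) p⟩
  have := RingHom.ker_isPrime (linearPullback L).toRingHom
  have hdim := height_add_ringKrullDim_quotient_le (RingHom.ker (linearPullback L).toRingHom)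
  rw [ringKrullDim_eq_of_ringEquiv (RingHom.quotientKerEquivOfSurjective hsurj),
    MvPolynomial.ringKrullDim_of_isNoetherianRing, MvPolynomial.ringKrullDim_of_isNoetherianRing,
    ringKrullDim_eq_zero_of_field, zero_add, zero_add, Nat.card_eq_fintype_card,
    Nat.card_eq_fintype_card] at hdim
  exact_mod_cast hdim

/-- The generic member of a family of linear maps `v ↦ F(s) *ᵥ v` that is polynomial in `s`, pulled
back to the coordinate ring `MvPolynomial τ K ⧸ I` of a subvariety. -/
def familyPullback (F : Matrix σ τ K[X]) (I : Ideal (MvPolynomial τ K)) :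
    MvPolynomial σ K →+* (MvPolynomial τ K ⧸ I)[X] :=
  (aeval fun i => ∑ j, (F i j).map (algebraMap K (MvPolynomial τ K ⧸ I)) *
    Polynomial.C (Ideal.Quotient.mk I (X j)) :
      MvPolynomial σ K →ₐ[K] (MvPolynomial τ K ⧸ I)[X]).toRingHom

theorem eval_familyPullback (F : Matrix σ τ K[X]) (I : Ideal (MvPolynomial τ K)) (s : K)
    (p : MvPolynomial σ K) :
    (familyPullback F I p).eval (algebraMap K _ s) =
      Ideal.Quotient.mk I (linearPullback (F.map (Polynomial.eval s)) p) := by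
  have hC (c : K) : Ideal.Quotient.mk I (C c) = algebraMap K (MvPolynomial τ K ⧸ I) c := rfl
  rw [← Polynomial.coe_evalRingHom, ← RingHom.comp_apply, ← AlgHom.coe_toRingHom (linearPullback _),
    ← RingHom.comp_apply (Ideal.Quotient.mk I)]
  congr 1
  refine MvPolynomial.ringHom_ext (fun c => ?_) fun i => ?_
  · simp [familyPullback, hC]
  · simp [familyPullback, linearPullback, hC, Matrix.toMvPolynomial, Polynomial.eval_finsetSum,
      ← MvPolynomial.C_mul_X_eq_monomial, Polynomial.eval_map_algebraMap,
      Polynomial.aeval_algebraMap_apply]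

theorem vanishingIdeal_iUnion_mulVec_image (F : Matrix σ τ K[X]) {S : Set (τ → K)}
    (hS : (vanishingIdeal K S).IsPrime) {T : Set K} (hT : T.Infinite) :
    vanishingIdeal K (⋃ s ∈ T, (F.map (Polynomial.eval s)).mulVec '' S) =
      RingHom.ker (familyPullback F (vanishingIdeal K S)) := by
  ext p
  have hp : p ∈ vanishingIdeal K (⋃ s ∈ T, (F.map (Polynomial.eval s)).mulVec '' S) ↔
      ∀ s ∈ T, (familyPullback F (vanishingIdeal K S) p).eval (algebraMap K _ s) = 0 := by
    simp only [eval_familyPullback, Ideal.Quotient.eq_zero_iff_mem, ← Ideal.mem_comap,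
      ← vanishingIdeal_mulVec_image, mem_vanishingIdeal_iff, Set.mem_iUnion, exists_prop]
    exact ⟨fun h s hs v hv => h v ⟨s, hs, hv⟩, fun h v ⟨s, hs, hv⟩ => h s hs v hv⟩
  rw [hp, RingHom.mem_ker]
  refine ⟨fun h => Polynomial.eq_zero_of_infinite_isRoot _ <|
    (hT.image (algebraMap K (MvPolynomial τ K ⧸ vanishingIdeal K S)).injective.injOn).mono ?_,
    fun h s _ => by rw [h, Polynomial.eval_zero]⟩
  rintro _ ⟨s, hs, rfl⟩
  exact h s hs

theorem isPrime_vanishingIdeal_iUnion (F : Matrix σ τ K[X]) {S : Set (τ → K)}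
    (hS : (vanishingIdeal K S).IsPrime) {T : Set K} (hT : T.Infinite) :
    (vanishingIdeal K (⋃ s ∈ T, (F.map (Polynomial.eval s)).mulVec '' S)).IsPrime :=
  vanishingIdeal_iUnion_mulVec_image F hS hT ▸ RingHom.ker_isPrime _

end LinearPullback

section Orbit

open MvPolynomial
open scoped Pointwise

theorem exists_apply_le_apply_succ {a : ℕ → ℕ∞} {d : ℕ} (h : a 0 ≤ d) :
    ∃ N ≤ d, a N ≤ a (N + 1) := by
  by_contra! hlt
  have hbound : ∀ N ≤ d + 1, a N + N ≤ d := fun N => by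
    induction N with
    | zero => simpa using h
    | succ N ih =>
      intro hN
      refine le_trans ?_ (ih (by omega))
      rw [Nat.cast_succ, add_comm (N : ℕ∞), ← add_assoc]
      gcongr
      exact Order.add_one_le_of_lt (hlt N (by omega))
  exact (Nat.lt_succ_self d).not_ge (by exact_mod_cast le_add_self.trans (hbound (d + 1) le_rfl))

variable {K σ G : Type*} [Field K] [Fintype σ] [DecidableEq σ] [Group G]
  (ρ : G →* Matrix σ σ K)

theorem comap_comap_linearPullback_inv (g : G) (J : Ideal (MvPolynomial σ K)) :
    (J.comap (linearPullback (ρ g))).comap (linearPullback (ρ g⁻¹)) = J := by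
  rw [← comap_linearPullback_mul, ← map_mul, inv_mul_cancel, map_one, linearPullback_one]
  exact Ideal.comap_id J

/-- The stabilizer of a polynomial ideal under the action of `G` by linear substitutions. -/
def idealStabilizer (J : Ideal (MvPolynomial σ K)) : Subgroup G where
  carrier := {g | J.comap (linearPullback (ρ g)) = J}
  one_mem' := by
    rw [Set.mem_ofPred_eq, map_one, linearPullback_one]
    exact Ideal.comap_id J
  mul_mem' {g h} hg hh := by
    rw [Set.mem_ofPred_eq] at hg hh ⊢
    rw [map_mul, comap_linearPullback_mul, hh, hg]
  inv_mem' {g} hg := by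
    rw [Set.mem_ofPred_eq] at hg ⊢
    nth_rw 1 [← hg]
    exact comap_comap_linearPullback_inv ρ g J

variable {ρ}

theorem mem_idealStabilizer {J : Ideal (MvPolynomial σ K)} {g : G} :
    g ∈ idealStabilizer ρ J ↔ J.comap (linearPullback (ρ g)) = J := .rfl

theorem inv_mul_mem_idealStabilizer {J : Ideal (MvPolynomial σ K)} {g h : G}
    (hgh : J.comap (linearPullback (ρ g)) = J.comap (linearPullback (ρ h))) :
    g⁻¹ * h ∈ idealStabilizer ρ J := by
  rw [mem_idealStabilizer, map_mul, comap_linearPullback_mul, ← hgh,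
    comap_comap_linearPullback_inv]

theorem mem_idealStabilizer_iff_le {J : Ideal (MvPolynomial σ K)} {g : G} :
    g ∈ idealStabilizer ρ J ↔
      J ≤ J.comap (linearPullback (ρ g)) ∧ J ≤ J.comap (linearPullback (ρ g⁻¹)) := by
  refine ⟨fun hg => ⟨(mem_idealStabilizer.1 hg).ge, (mem_idealStabilizer.1 (inv_mem hg)).ge⟩,
    fun ⟨hg, hg'⟩ => mem_idealStabilizer.2 (le_antisymm ?_ hg)⟩
  have := comap_comap_linearPullback_inv ρ g⁻¹ J
  rw [inv_inv] at this
  exact (Ideal.comap_mono hg').trans_eq this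

theorem isClosed_idealStabilizer [TopologicalSpace K] [IsTopologicalRing K] [T1Space K]
    [TopologicalSpace G] [IsTopologicalGroup G] (hρ : Continuous ρ) (S : Set (σ → K)) :
    IsClosed (idealStabilizer ρ (vanishingIdeal K S) : Set G) := by
  have hle : IsClosed
      {g | vanishingIdeal K S ≤ (vanishingIdeal K S).comap (linearPullback (ρ g))} := by
    have : {g | vanishingIdeal K S ≤ (vanishingIdeal K S).comap (linearPullback (ρ g))} =
        ⋂ p ∈ vanishingIdeal K S, ⋂ w ∈ S, {g | eval ((ρ g).mulVec w) p = 0} := by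
      ext g
      simp only [SetLike.le_def, Ideal.mem_comap, mem_vanishingIdeal_iff, aeval_linearPullback,
        aeval_eq_eval, Set.mem_ofPred_eq, Set.mem_iInter]
    rw [this]
    refine isClosed_biInter fun p _ => isClosed_biInter fun w _ => isClosed_singleton.preimage ?_
    exact (continuous_eval p).comp (hρ.matrix_mulVec continuous_const)
  convert hle.inter (hle.preimage continuous_inv) using 1
  ext g
  exact mem_idealStabilizer_iff_le

variable (ρ) in
/-- The ideal of polynomials vanishing on the points `g • v` with `g ∈ A`; its zero locus is the
Zariski closure of this part of the orbit of `v`. -/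
def orbitIdeal (v : σ → K) (A : Set G) : Ideal (MvPolynomial σ K) :=
  vanishingIdeal K ((fun g => (ρ g).mulVec v) '' A)

variable {v : σ → K}

theorem mem_orbitIdeal {A : Set G} {p : MvPolynomial σ K} :
    p ∈ orbitIdeal ρ v A ↔ ∀ g ∈ A, aeval ((ρ g).mulVec v) p = 0 := by
  simp only [orbitIdeal, mem_vanishingIdeal_iff, Set.forall_mem_image]

theorem orbitIdeal_anti {A B : Set G} (h : A ⊆ B) : orbitIdeal ρ v B ≤ orbitIdeal ρ v A :=
  vanishingIdeal_anti_mono (Set.image_mono h)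

theorem comap_orbitIdeal (g : G) (A : Set G) :
    (orbitIdeal ρ v A).comap (linearPullback (ρ g)) = orbitIdeal ρ v (g • A) := by
  ext p
  simp only [Ideal.mem_comap, mem_orbitIdeal, aeval_linearPullback, Matrix.mulVec_mulVec,
    ← map_mul, ← Set.image_smul, Set.forall_mem_image, smul_eq_mul]

theorem orbitIdeal_eq_univ {A : Set G} (hA : A.Nonempty)
    (h : idealStabilizer ρ (orbitIdeal ρ v A) = ⊤) :
    orbitIdeal ρ v A = orbitIdeal ρ v Set.univ := by
  refine le_antisymm (fun p hp => mem_orbitIdeal.2 fun g _ => ?_) (orbitIdeal_anti A.subset_univ)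
  obtain ⟨a, ha⟩ := hA
  have hg : (orbitIdeal ρ v A).comap (linearPullback (ρ (g * a⁻¹))) = orbitIdeal ρ v A :=
    mem_idealStabilizer.1 (h ▸ Subgroup.mem_top _)
  rw [← hg, comap_orbitIdeal] at hp
  simpa using mem_orbitIdeal.1 hp _ (Set.smul_mem_smul_set ha)

variable {T : Type*} {γ : T → G} {τ : T → K} {F : Matrix σ σ K[X]}

theorem isPrime_orbitIdeal_range_mul (hτ : (Set.range τ).Infinite)
    (hF : ∀ s, ρ (γ s) = F.map (Polynomial.eval (τ s))) {A : Set G}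
    (hA : (orbitIdeal ρ v A).IsPrime) : (orbitIdeal ρ v (Set.range γ * A)).IsPrime := by
  convert isPrime_vanishingIdeal_iUnion F hA hτ using 1
  rw [orbitIdeal]
  congr 1
  rw [Set.biUnion_range]
  ext w
  simp only [← hF, Set.mem_image, Set.mem_mul, Set.mem_range, Set.mem_iUnion]
  constructor
  · rintro ⟨_, ⟨_, ⟨s, rfl⟩, a, ha, rfl⟩, rfl⟩
    exact ⟨s, _, ⟨a, ha, rfl⟩, by rw [Matrix.mulVec_mulVec, ← map_mul]⟩
  · rintro ⟨s, _, ⟨a, ha, rfl⟩, rfl⟩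
    exact ⟨_, ⟨_, ⟨s, rfl⟩, a, ha, rfl⟩, by rw [Matrix.mulVec_mulVec, ← map_mul]⟩

theorem smul_mul_eq_of_mem_center {Z : Subgroup G} {z : G} (hz : z ∈ Z)
    (hcenter : z ∈ Subgroup.center G) (A : Set G) : z • (A * (Z : Set G)) = A * Z := by
  have hA : z • A = MulOpposite.op z • A :=
    Set.image_congr fun a _ => (Subgroup.mem_center_iff.1 hcenter a).symm
  rw [← smul_mul_assoc, hA, Set.op_smul_set_mul_eq_mul_smul_set, smul_coe_set hz]

theorem exists_orbitIdeal_succ_eq_comap (hτ : (Set.range τ).Infinite)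
    (hF : ∀ s, ρ (γ s) = F.map (Polynomial.eval (τ s))) {Z : Set G}
    (hZ : (orbitIdeal ρ v Z).IsPrime) {d : ℕ} (hd : (orbitIdeal ρ v Z).height ≤ d) :
    ∃ N ≤ d, ∀ s, orbitIdeal ρ v (Set.range γ ^ (N + 1) * Z) =
      (orbitIdeal ρ v (Set.range γ ^ N * Z)).comap (linearPullback (ρ (γ s))) := by
  have hprime : ∀ N, (orbitIdeal ρ v (Set.range γ ^ N * Z)).IsPrime := fun N => by
    induction N with
    | zero => rwa [pow_zero, one_mul]
    | succ N ih =>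
      rw [pow_succ', mul_assoc]
      exact isPrime_orbitIdeal_range_mul hτ hF ih
  obtain ⟨N, hN, hle⟩ := exists_apply_le_apply_succ
    (a := fun N => (orbitIdeal ρ v (Set.range γ ^ N * Z)).height) (d := d)
    (by simpa only [pow_zero, one_mul] using hd)
  refine ⟨N, hN, fun s => ?_⟩
  have := hprime (N + 1)
  refine Ideal.eq_of_le_of_height_le (I := orbitIdeal ρ v _) ?_ ?_
  · rw [comap_orbitIdeal, pow_succ', mul_assoc]
    exact orbitIdeal_anti (Set.smul_set_subset_mul ⟨s, rfl⟩)
  · rwa [height_comap_linearPullback ((Group.isUnit (γ s)).map ρ)]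

/-- The irreducible closures of `γ(T)ᴺ Z v` increase with `N`, up to translation, so their
dimensions stabilize. -/
theorem orbitIdeal_range_pow_mul_eq_univ [TopologicalSpace K] [IsTopologicalRing K] [T1Space K]
    [TopologicalSpace G] [IsTopologicalGroup G] (hρ : Continuous ρ)
    (hτ : (Set.range τ).Infinite) (hF : ∀ s, ρ (γ s) = F.map (Polynomial.eval (τ s)))
    {Z : Subgroup G} (hZ : Z ≤ Subgroup.center G) (hprime : (orbitIdeal ρ v (Z : Set G)).IsPrime)
    {d : ℕ} (hd : (orbitIdeal ρ v (Z : Set G)).height ≤ d)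
    (hgen : ∀ H : Subgroup G, IsClosed (H : Set G) → Z ≤ H → (∀ s s', (γ s')⁻¹ * γ s ∈ H) → H = ⊤)
    {N : ℕ} (hN : d ≤ N) :
    orbitIdeal ρ v (Set.range γ ^ N * Z) = orbitIdeal ρ v Set.univ := by
  obtain ⟨_, s₀, -⟩ := hτ.nonempty
  have : Nonempty T := ⟨s₀⟩
  obtain ⟨N₀, hN₀, hstep⟩ := exists_orbitIdeal_succ_eq_comap hτ hF hprime hd
  have hstable : orbitIdeal ρ v (Set.range γ ^ N₀ * Z) = orbitIdeal ρ v Set.univ := by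
    refine orbitIdeal_eq_univ ((Set.range_nonempty γ).pow.mul ⟨1, Z.one_mem⟩)
      (hgen _ (isClosed_idealStabilizer hρ _) (fun z hz => ?_) fun s s' => ?_)
    · rw [mem_idealStabilizer, comap_orbitIdeal, smul_mul_eq_of_mem_center hz (hZ hz)]
    · exact inv_mul_mem_idealStabilizer ((hstep s').symm.trans (hstep s))
  replace hN := hN₀.trans hN
  induction N, hN using Nat.le_induction with
  | base => exact hstable
  | succ N _ ih =>
    refine le_antisymm ?_ (orbitIdeal_anti (Set.subset_univ _))
    calc orbitIdeal ρ v (Set.range γ ^ (N + 1) * Z)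
        ≤ orbitIdeal ρ v (γ s₀ • (Set.range γ ^ N * (Z : Set G))) := by
          rw [pow_succ', mul_assoc]
          exact orbitIdeal_anti (Set.smul_set_subset_mul ⟨s₀, rfl⟩)
      _ = orbitIdeal ρ v Set.univ := by
          rw [← comap_orbitIdeal, ih, comap_orbitIdeal, Set.smul_set_univ]

end Orbit

section UnitGroup

open MvPolynomial

variable {𝕜 A σ : Type*} [Field 𝕜] [Ring A] [Algebra 𝕜 A] [Fintype σ] [DecidableEq σ]

/-- The linear representation of the unit group of a finite-dimensional algebra `A` on `A` by left
multiplication. The orbit of `1` realizes `Aˣ` as a subset of the affine space `A`. -/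
def leftMulRep (b : Module.Basis σ 𝕜 A) : Aˣ →* Matrix σ σ 𝕜 :=
  (Algebra.leftMulMatrix b).toMonoidHom.comp (Units.coeHom A)

theorem leftMulRep_apply (b : Module.Basis σ 𝕜 A) (u : Aˣ) :
    leftMulRep b u = Algebra.leftMulMatrix b u := rfl

theorem leftMulRep_mulVec_one (b : Module.Basis σ 𝕜 A) (u : Aˣ) :
    (leftMulRep b u).mulVec (b.equivFun 1) = b.equivFun u :=
  (Algebra.leftMulMatrix_mulVec_repr b (u : A) 1).trans (by rw [mul_one]; rfl)

theorem aeval_eq_zero_of_orbitIdeal_eq_univ {b : Module.Basis σ 𝕜 A} {S : Set Aˣ}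
    (hS : orbitIdeal (leftMulRep b) (b.equivFun 1) S =
      orbitIdeal (leftMulRep b) (b.equivFun 1) Set.univ)
    {τ : Type*} [Finite τ] (f : A →ₗ[𝕜] τ → 𝕜) {p : MvPolynomial τ 𝕜}
    (hp : ∀ u ∈ S, aeval (f u) p = 0) (u : Aˣ) : aeval (f u) p = 0 := by
  have hf (u : Aˣ) : aeval ((leftMulRep b u).mulVec (b.equivFun 1))
      (linearPullback (LinearMap.toMatrix b (Pi.basisFun 𝕜 τ) f) p) = aeval (f u) p := by
    rw [leftMulRep_mulVec_one, aeval_linearPullback]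
    congr 1
    exact congrArg _ (LinearMap.toMatrix_mulVec_repr b (Pi.basisFun 𝕜 τ) f u)
  have hmem : linearPullback (LinearMap.toMatrix b (Pi.basisFun 𝕜 τ) f) p ∈
      orbitIdeal (leftMulRep b) (b.equivFun 1) Set.univ :=
    hS ▸ mem_orbitIdeal.2 fun u hu => (hf u).trans (hp u hu)
  exact (hf u).symm.trans (mem_orbitIdeal.1 hmem u (Set.mem_univ u))

end UnitGroup

section ScalarCone

open MvPolynomial

variable {𝕜 R ι : Type*} [NontriviallyNormedField 𝕜] [CommRing R] [Algebra 𝕜 R]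

theorem vanishingIdeal_mulVec_image_of_dense {σ τ : Type*} [Fintype τ] (L : Matrix σ τ 𝕜)
    {U : Set (τ → 𝕜)} (hU : Dense U) :
    vanishingIdeal 𝕜 (L.mulVec '' U) = RingHom.ker (linearPullback L) := by
  have hbot : vanishingIdeal 𝕜 U = ⊥ := by
    refine (Submodule.eq_bot_iff _).2 fun p hp => MvPolynomial.funext fun w => ?_
    exact congrFun (Continuous.ext_on hU (continuous_eval p) (continuous_eval 0) fun w hw => by
      simpa [aeval_eq_eval] using mem_vanishingIdeal_iff.1 hp w hw) w
  rw [vanishingIdeal_mulVec_image, hbot]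
  rfl

variable [Fintype ι] [DecidableEq ι]

/-- The inclusion of the scalar matrices into `Mat₂(R)`, in coordinates. -/
def scalarInclusion (b : Module.Basis ι 𝕜 R) : Matrix (Fin 2 × Fin 2 × ι) ι 𝕜 :=
  LinearMap.toMatrix b (b.matrix (Fin 2) (Fin 2))
    ((Algebra.linearMap R (Matrix (Fin 2) (Fin 2) R)).restrictScalars 𝕜)

theorem exists_mul_scalarInclusion_eq_one (b : Module.Basis ι 𝕜 R) :
    ∃ L' : Matrix ι (Fin 2 × Fin 2 × ι) 𝕜, L' * scalarInclusion b = 1 := by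
  refine ⟨LinearMap.toMatrix (b.matrix (Fin 2) (Fin 2)) b (Matrix.entryLinearMap 𝕜 R 0 0), ?_⟩
  rw [scalarInclusion, ← LinearMap.toMatrix_comp, ← LinearMap.toMatrix_id b]
  congr 1

variable [Module.Finite 𝕜 R] [TopologicalSpace R] [IsModuleTopology 𝕜 R]

variable (𝕜) in
include 𝕜 in
theorem dense_isUnit : Dense {u : R | IsUnit u} := fun a => by
  have : Tendsto (fun z => a + algebraMap 𝕜 R z) (𝓝[≠] 0) (𝓝 a) := by
    have := IsModuleTopology.toContinuousAdd 𝕜 R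
    have hcont : Continuous fun z => a + algebraMap 𝕜 R z :=
      continuous_const.add
        (IsModuleTopology.continuous_of_linearMap (Algebra.linearMap 𝕜 R))
    simpa using (hcont.tendsto 0).mono_left nhdsWithin_le_nhds
  exact mem_closure_of_tendsto this (eventually_isUnit_add_algebraMap a)

theorem orbitIdeal_center (b : Module.Basis ι 𝕜 R) :
    orbitIdeal (leftMulRep (b.matrix (Fin 2) (Fin 2))) ((b.matrix (Fin 2) (Fin 2)).equivFun 1)
      (Subgroup.center (GL (Fin 2) R) : Set (GL (Fin 2) R)) =
      RingHom.ker (linearPullback (scalarInclusion b)) := by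
  have hU : Dense (b.equivFun '' {u | IsUnit u}) :=
    b.equivFun.surjective.denseRange.dense_image
      (IsModuleTopology.continuous_of_linearMap b.equivFun.toLinearMap) (dense_isUnit 𝕜)
  rw [← vanishingIdeal_mulVec_image_of_dense _ hU, orbitIdeal,
    Matrix.GeneralLinearGroup.center_eq_range_scalar, MonoidHom.coe_range, ← Set.range_comp,
    Set.image_image]
  congr 1
  have (u : Rˣ) : (b.matrix (Fin 2) (Fin 2)).equivFun (Matrix.GeneralLinearGroup.scalar (Fin 2) u :
      GL (Fin 2) R).val = (scalarInclusion b).mulVec (b.equivFun u) :=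
    (LinearMap.toMatrix_mulVec_repr b (b.matrix (Fin 2) (Fin 2))
      ((Algebra.linearMap R (Matrix (Fin 2) (Fin 2) R)).restrictScalars 𝕜) (u : R)).symm
  ext w
  simp only [Set.mem_image, Set.mem_range, leftMulRep_mulVec_one, Function.comp_apply, this]
  exact ⟨fun ⟨u, hu⟩ => ⟨u, u.isUnit, hu⟩, fun ⟨_, ⟨u, rfl⟩, hu⟩ => ⟨u, hu⟩⟩

theorem isPrime_orbitIdeal_center (b : Module.Basis ι 𝕜 R) :
    (orbitIdeal (leftMulRep (b.matrix (Fin 2) (Fin 2))) ((b.matrix (Fin 2) (Fin 2)).equivFun 1)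
      (Subgroup.center (GL (Fin 2) R) : Set (GL (Fin 2) R))).IsPrime :=
  orbitIdeal_center b ▸ RingHom.ker_isPrime _

theorem height_orbitIdeal_center_le (b : Module.Basis ι 𝕜 R) :
    (orbitIdeal (leftMulRep (b.matrix (Fin 2) (Fin 2))) ((b.matrix (Fin 2) (Fin 2)).equivFun 1)
      (Subgroup.center (GL (Fin 2) R) : Set (GL (Fin 2) R))).height ≤
      (3 * Fintype.card ι : ℕ) := by
  obtain ⟨L', hL'⟩ := exists_mul_scalarInclusion_eq_one b
  have h := height_ker_linearPullback_add_card_le hL'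
  rw [← orbitIdeal_center, show Fintype.card (Fin 2 × Fin 2 × ι) =
    3 * Fintype.card ι + Fintype.card ι by simp; ring, Nat.cast_add] at h
  exact (ENat.add_le_add_iff_right (ENat.natCast_ne_top _)).1 h

end ScalarCone

section CurveProducts

open scoped Pointwise

theorem continuous_leftMulRep {𝕜 A σ : Type*} [NontriviallyNormedField 𝕜] [Ring A] [Algebra 𝕜 A]
    [TopologicalSpace A] [IsModuleTopology 𝕜 A] [Fintype σ] [DecidableEq σ]
    (b : Module.Basis σ 𝕜 A) : Continuous (leftMulRep b) :=
  (IsModuleTopology.continuous_of_linearMap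
    (Algebra.leftMulMatrix b).toLinearMap).comp Units.continuous_val

section CurveFamily

variable {𝕜 R σ : Type*} [Field 𝕜] [CommRing R] [Algebra 𝕜 R] [Fintype σ] [DecidableEq σ]
  (b : Module.Basis σ 𝕜 (Matrix (Fin 2) (Fin 2) R))

/-- Left multiplication by `curveMatrix x y s` in coordinates, as a polynomial family in `s`. -/
def curveFamily (x y : R) : Matrix σ σ 𝕜[X] :=
  (Algebra.leftMulMatrix b !![x, 0; x, 0]).map Polynomial.C +
    (Polynomial.X : 𝕜[X]) • (Algebra.leftMulMatrix b !![-x, -y; -1, -x]).map Polynomial.C +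
    (Polynomial.X ^ 2 : 𝕜[X]) • (Algebra.leftMulMatrix b !![0, y; 0, 1]).map Polynomial.C

theorem leftMulMatrix_curveMatrix (x y : R) (s : 𝕜) :
    Algebra.leftMulMatrix b (curveMatrix x y (algebraMap 𝕜 R s)) =
      (curveFamily b x y).map (Polynomial.eval s) := by
  have : curveMatrix x y (algebraMap 𝕜 R s) = !![x, 0; x, 0] + s • !![-x, -y; -1, -x] +
      s ^ 2 • !![0, y; 0, 1] := by
    ext i j
    rw [Matrix.add_apply, Matrix.add_apply, Matrix.smul_apply, Matrix.smul_apply,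
      Algebra.smul_def, Algebra.smul_def]
    fin_cases i <;> fin_cases j <;> simp [curveMatrix] <;> ring
  rw [this, map_add, map_add, map_smul, map_smul]
  ext i j
  simp [curveFamily, mul_comm s, mul_comm (s ^ 2)]

end CurveFamily

variable {𝕜 R : Type*} [NontriviallyNormedField 𝕜] [IsAlgClosed 𝕜] [NeZero (2 : 𝕜)] [CommRing R]
  [Algebra 𝕜 R] [Module.Finite 𝕜 R] [TopologicalSpace R] [IsModuleTopology 𝕜 R]

local notation "κ" => algebraMap 𝕜 R

theorem aeval_eq_zero_of_curve_products {x : 𝕜} (hx0 : x ≠ 0) (hx1 : x ≠ 1) {y : R}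
    (hadj : Algebra.adjoin 𝕜 {y} = ⊤) (hy0 : IsUnit y) (hy1 : IsUnit (y - 1))
    (hyx : IsUnit (y - κ x)) {T : Type*} {τ : T → 𝕜} (hτ : Set.range τ = {0, 1, x}ᶜ)
    {γ : T → GL (Fin 2) R} (hγ : ∀ s, (γ s).val = curveMatrix (κ x) y (κ (τ s)))
    {N : ℕ} (hN : 3 * Module.finrank 𝕜 R ≤ N)
    {υ : Type*} [Finite υ] (f : Matrix (Fin 2) (Fin 2) R →ₗ[𝕜] υ → 𝕜) {p : MvPolynomial υ 𝕜}
    (hp : ∀ u ∈ Set.range γ ^ N * (Subgroup.center (GL (Fin 2) R) : Set (GL (Fin 2) R)),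
      p.aeval (f u.val) = 0) (u : GL (Fin 2) R) : p.aeval (f u.val) = 0 := by
  let b := Module.finBasis 𝕜 R
  have := IsModuleTopology.isTopologicalRing 𝕜 R
  have : IsModuleTopology 𝕜 (Matrix (Fin 2) (Fin 2) R) :=
    inferInstanceAs (IsModuleTopology 𝕜 (Fin 2 → Fin 2 → R))
  have hgen (H : Subgroup (GL (Fin 2) R)) (hH : IsClosed (H : Set (GL (Fin 2) R)))
      (hcenter : Subgroup.center _ ≤ H) (hquot : ∀ s s', (γ s')⁻¹ * γ s ∈ H) : H = ⊤ := by
    rw [Matrix.GeneralLinearGroup.center_eq_range_scalar] at hcenter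
    refine eq_top_of_curve_quotients_mem hH (fun u => hcenter ⟨u, rfl⟩) hx0 hx1 hadj hy0 hy1 hyx ?_
    intro s hs s' hs' g g' hg hg'
    obtain ⟨r, rfl⟩ : s ∈ Set.range τ := hτ ▸ hs
    obtain ⟨r', rfl⟩ : s' ∈ Set.range τ := hτ ▸ hs'
    obtain rfl : g = γ r := Units.ext (hg.trans (hγ r).symm)
    obtain rfl : g' = γ r' := Units.ext (hg'.trans (hγ r').symm)
    exact hquot r r'
  have hfamily (s) : leftMulRep (b.matrix (Fin 2) (Fin 2)) (γ s) =
      (curveFamily (b.matrix (Fin 2) (Fin 2)) (κ x) y).map (Polynomial.eval (τ s)) := by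
    rw [leftMulRep_apply, hγ, leftMulMatrix_curveMatrix]
  exact aeval_eq_zero_of_orbitIdeal_eq_univ
    (orbitIdeal_range_pow_mul_eq_univ (continuous_leftMulRep _)
      (hτ ▸ (Set.toFinite _).infinite_compl) hfamily le_rfl (isPrime_orbitIdeal_center b)
      (height_orbitIdeal_center_le b) hgen (by rwa [Fintype.card_fin])) f hp u

end CurveProducts

section ProductGroup

variable {ι : Type*} {R : ι → Type*} [∀ i, CommRing (R i)]

/-- The identification of `GL₂` of a product of rings with the product of the groups `GL₂`. -/
def glPiEquiv : GL (Fin 2) (∀ i, R i) ≃* ∀ i, GL (Fin 2) (R i) :=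
  (Units.mapEquiv Matrix.piRingEquiv.toMulEquiv).trans MulEquiv.piUnits

/-- The projection of `GL₂` of a product of rings onto the product of the groups `PGL₂`. -/
def glPiToPGL : GL (Fin 2) (∀ i, R i) →* ∀ i, PGL(2, R i) :=
  (MonoidHom.piMap fun _ => Matrix.ProjGenLinGroup.mk).comp glPiEquiv.toMonoidHom

theorem glPiToPGL_surjective : Function.Surjective (glPiToPGL (R := R)) :=
  (Function.Surjective.piMap fun _ => Matrix.ProjGenLinGroup.mk_surjective).comp
    glPiEquiv.surjective

theorem glPiToPGL_scalar (u : (∀ i, R i)ˣ) :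
    glPiToPGL (Matrix.GeneralLinearGroup.scalar (Fin 2) u) = 1 := by
  funext i
  rw [Pi.one_apply, ← Matrix.ProjGenLinGroup.mk_scalar (Units.map (Pi.evalMonoidHom R i) u)]
  refine congrArg Matrix.ProjGenLinGroup.mk ?_
  ext a b
  fin_cases a <;> fin_cases b <;> rfl

theorem continuous_glPiToPGL [∀ i, TopologicalSpace (R i)] :
    Continuous (glPiToPGL (R := R)) :=
  continuous_pi fun i => continuous_coinduced_rng.comp <|
    (Continuous.units_map ((Pi.evalRingHom R i).mapMatrix.toMonoidHom :
      Matrix (Fin 2) (Fin 2) (∀ i, R i) →* Matrix (Fin 2) (Fin 2) (R i))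
      (continuous_id.matrix_map (continuous_apply i)) :)

end ProductGroup

instance (R : Type*) [CommRing R] [TopologicalSpace R] [IsTopologicalRing R] :
    IsTopologicalGroup PGL(2, R) :=
  inferInstanceAs (IsTopologicalGroup (GL (Fin 2) R ⧸ Subgroup.center (GL (Fin 2) R)))

section TruncPoly

/-- The linear isomorphism between `ℂ[ε]` and `ℂ ^ (n + 1)` that is given by `coeffs`. -/
def coeffsEquiv (n : ℕ) : TruncPoly n ≃ₗ[ℂ] (Fin (n + 1) → ℂ) :=
  ((AdjoinRoot.powerBasisAux' (Polynomial.monic_X_pow (R := ℂ) (n + 1))).reindex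
    (finCongr (Polynomial.natDegree_X_pow (n + 1)))).equivFun

theorem coe_coeffsEquiv (n : ℕ) : ⇑(coeffsEquiv n) = coeffs n := by
  ext u j
  simp [coeffsEquiv, coeffs]

instance (n : ℕ) : Module.Finite ℂ (TruncPoly n) :=
  Module.Finite.equiv (coeffsEquiv n).symm

instance (n : ℕ) : IsModuleTopology ℂ (TruncPoly n) :=
  IsModuleTopology.iso (R := ℂ)
    { (coeffsEquiv n).symm with
      continuous_toFun := continuous_induced_rng.2 <| by
        rw [← coe_coeffsEquiv]
        exact continuous_id.congr fun u => ((coeffsEquiv n).apply_symm_apply u).symm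
      continuous_invFun := continuous_induced_dom.congr (congrFun (coe_coeffsEquiv n).symm) }

instance (n : ℕ) : IsTopologicalRing (TruncPoly n) := IsModuleTopology.isTopologicalRing ℂ _

variable {ι : Type*} (n : ι → ℕ)

theorem finrank_pi_truncPoly [Fintype ι] :
    Module.finrank ℂ (∀ i, TruncPoly (n i)) = ∑ i, (n i + 1) := by
  simp_rw [Module.finrank_pi_fintype ℂ (M := fun i => TruncPoly (n i)),
    (coeffsEquiv _).finrank_eq, Module.finrank_fin_fun]

/-- The element `(tᵢ + εᵢ)ᵢ` of `∏ᵢ ℂ[εᵢ]`. -/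
def piParam (t : ι → ℂ) : ∀ i, TruncPoly (n i) := fun i => const (n i) (t i) + eps (n i)

theorem isUnit_piParam_sub {t : ι → ℂ} {c : ℂ} (h : ∀ i, t i ≠ c) :
    IsUnit (piParam n t - algebraMap ℂ _ c) := Pi.isUnit_iff.2 fun i => by
  have hnil : IsNilpotent (eps (n i)) := ⟨n i + 1, eps_pow (n i)⟩
  have : (piParam n t - algebraMap ℂ _ c) i = const (n i) (t i - c) + eps (n i) := by
    rw [map_sub, sub_add_eq_add_sub]
    rfl
  rw [this]
  exact hnil.isUnit_add_left_of_commute ((sub_ne_zero.2 (h i)).isUnit.map _) (Commute.all _ _)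

theorem aeval_piParam_apply (t : ι → ℂ) (Q : ℂ[X]) (i : ι) :
    Polynomial.aeval (piParam n t) Q i = Polynomial.aeval (const (n i) (t i) + eps (n i)) Q :=
  (Polynomial.aeval_algHom_apply (Pi.evalAlgHom ℂ (fun i => TruncPoly (n i)) i) _ Q).symm

theorem aeval_const_add_eps_eq_mk {n : ℕ} {t : ℂ} {p Q : ℂ[X]}
    (h : (Polynomial.X - Polynomial.C t) ^ (n + 1) ∣ Q - p.comp (Polynomial.X - Polynomial.C t)) :
    Polynomial.aeval (const n t + eps n) Q = AdjoinRoot.mk _ p := by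
  have h := map_dvd (Polynomial.aeval (const n t + eps n)) h
  have hroot : const n t + eps n - algebraMap ℂ _ t = eps n := add_sub_cancel_left _ _
  rw [map_pow, map_sub, map_sub, Polynomial.aeval_comp, map_sub, Polynomial.aeval_X,
    Polynomial.aeval_C, hroot, eps_pow, zero_dvd_iff, sub_eq_zero] at h
  exact h.trans (AdjoinRoot.aeval_eq p)

/-- By the Chinese remainder theorem `∏ᵢ ℂ[εᵢ]` is `ℂ[X] / ∏ᵢ (X - tᵢ) ^ (nᵢ + 1)`. -/
theorem adjoin_piParam [Finite ι] {t : ι → ℂ} (ht : Function.Injective t) :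
    Algebra.adjoin ℂ {piParam n t} = ⊤ := by
  cases nonempty_fintype ι
  rw [Algebra.adjoin_singleton_eq_range_aeval, eq_top_iff]
  intro u _
  choose p hp using fun i => AdjoinRoot.mk_surjective (u i)
  let I (i : ι) : Ideal ℂ[X] := Ideal.span {(Polynomial.X - Polynomial.C (t i)) ^ (n i + 1)}
  have hI : Pairwise fun i j => IsCoprime (I i) (I j) := fun i j hij =>
    (Ideal.isCoprime_span_singleton_iff _ _).2 (Polynomial.pairwise_coprime_X_sub_C ht hij).pow
  obtain ⟨Q, hQ⟩ := Ideal.pi_quotient_surjective hI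
    fun i => Ideal.Quotient.mk _ ((p i).comp (Polynomial.X - Polynomial.C (t i)))
  refine ⟨Q, funext fun i => ?_⟩
  refine (aeval_piParam_apply n t Q i).trans ((aeval_const_add_eps_eq_mk ?_).trans (hp i))
  exact Ideal.mem_span_singleton.1 (Ideal.Quotient.eq.1 (hQ i))

end TruncPoly

section ProdPGL

open scoped Pointwise

variable {k : ℕ} {n : Fin (k + 1) → ℕ} {t : Fin (k + 1) → ℂ} {x : ℂ}

/-- The lift of `gTuple` to `GL₂(∏ᵢ ℂ[εᵢ])`. -/
def gTupleLift (n : Fin (k + 1) → ℕ) (hx : ∀ i, x ≠ t i) (s : Param x) :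
    GL (Fin 2) (∀ i, TruncPoly (n i)) :=
  glPiEquiv.symm fun i => Matrix.GeneralLinearGroup.mk'' (gMatrix (n i) (t i) x s)
    (isUnit_det_gMatrix (n i) (hx i) s.2.1 s.2.2.1 s.2.2.2)

theorem glPiToPGL_gTupleLift (hx : ∀ i, x ≠ t i) (s : Param x) :
    glPiToPGL (gTupleLift n hx s) = gTuple n t x hx s := rfl

theorem coe_gTupleLift (hx : ∀ i, x ≠ t i) (s : Param x) :
    (gTupleLift n hx s).val =
      curveMatrix (algebraMap ℂ _ x) (piParam n t) (algebraMap ℂ _ (s : ℂ)) := by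
  ext a b i
  change gMatrix (n i) (t i) x s a b = _
  fin_cases a <;> fin_cases b <;>
    simp [gMatrix, curveMatrix, piParam, const]

theorem range_coe_param (x : ℂ) : Set.range (Subtype.val : Param x → ℂ) = {0, 1, x}ᶜ := by
  ext s
  simp

theorem eq_top_of_isClosed_of_gTuple_mem (ht : Function.Injective t) (ht0 : ∀ i, t i ≠ 0)
    (ht1 : ∀ i, t i ≠ 1) (hx0 : x ≠ 0) (hx1 : x ≠ 1) (hx : ∀ i, x ≠ t i)
    {H : Subgroup (ProdPGL n)} (hH : IsClosed (H : Set (ProdPGL n)))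
    (hg : ∀ s, gTuple n t x hx s ∈ H) : H = ⊤ := by
  have hlift (s) (hs : s ∉ ({0, 1, x} : Set ℂ)) (γ : GL (Fin 2) (∀ i, TruncPoly (n i)))
      (hγ : γ.val = curveMatrix (algebraMap ℂ _ x) (piParam n t) (algebraMap ℂ _ s)) :
      γ ∈ H.comap glPiToPGL := by
    obtain ⟨s, rfl⟩ : s ∈ Set.range (Subtype.val : Param x → ℂ) := range_coe_param x ▸ hs
    obtain rfl : γ = gTupleLift n hx s := Units.ext (hγ.trans (coe_gTupleLift hx s).symm)
    exact hg s
  have hcomap : H.comap glPiToPGL = ⊤ :=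
    eq_top_of_curve_quotients_mem (hH.preimage continuous_glPiToPGL)
      (fun u => by rw [Subgroup.mem_comap, glPiToPGL_scalar]; exact one_mem H) hx0 hx1
      (adjoin_piParam n ht) (by simpa using isUnit_piParam_sub n ht0)
      (by simpa using isUnit_piParam_sub n ht1) (isUnit_piParam_sub n fun i => (hx i).symm)
      fun s hs s' hs' γ γ' hγ hγ' => mul_mem (inv_mem (hlift s' hs' γ' hγ')) (hlift s hs γ hγ)
  exact Subgroup.comap_injective glPiToPGL_surjective (hcomap.trans (Subgroup.comap_top _).symm)

theorem dense_closure_range_gTuple (ht : Function.Injective t) (ht0 : ∀ i, t i ≠ 0)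
    (ht1 : ∀ i, t i ≠ 1) (hx0 : x ≠ 0) (hx1 : x ≠ 1) (hx : ∀ i, x ≠ t i) :
    Dense (Subgroup.closure (Set.range (gTuple n t x hx)) : Set (ProdPGL n)) := by
  have htop : (Subgroup.closure (Set.range (gTuple n t x hx))).topologicalClosure = ⊤ :=
    eq_top_of_isClosed_of_gTuple_mem ht ht0 ht1 hx0 hx1 hx (Subgroup.isClosed_topologicalClosure _)
      fun s => Subgroup.le_topologicalClosure _ (Subgroup.subset_closure (Set.mem_range_self s))
  rw [dense_iff_closure_eq, ← Subgroup.topologicalClosure_coe, htop, Subgroup.coe_top]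

theorem glPiToPGL_mem_range_phi (hx : ∀ i, x ≠ t i) {N : ℕ}
    {u : GL (Fin 2) (∀ i, TruncPoly (n i))} (hu : u ∈ Set.range (gTupleLift n hx) ^ N *
      (Subgroup.center (GL (Fin 2) (∀ i, TruncPoly (n i))) : Set (GL (Fin 2) _))) :
    glPiToPGL u ∈ Set.range (phi n t x hx N) := by
  obtain ⟨_, hγ, z, hz, rfl⟩ := hu
  obtain ⟨γ, rfl⟩ := Set.mem_pow.1 hγ
  choose s hs using fun j => (γ j).2
  rw [SetLike.mem_coe, Matrix.GeneralLinearGroup.center_eq_range_scalar] at hz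
  obtain ⟨z, rfl⟩ := hz
  refine ⟨s, ?_⟩
  simp only [map_mul, glPiToPGL_scalar, mul_one, map_list_prod, List.map_ofFn, Function.comp_def,
    ← hs, glPiToPGL_gTupleLift, phi]

theorem exists_mem_iff_of_isClosed_zariskiProdPGL {C : Set (ProdPGL n)}
    (hC : IsClosed[zariskiProdPGL n] C) :
    ∃ F : Set (MvPolynomial (Coord n) ℂ), ∀ A : ∀ i, GL (Fin 2) (TruncPoly (n i)),
      (fun i => (Matrix.ProjGenLinGroup.mk (A i) : PGL(2, TruncPoly (n i)))) ∈ C ↔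
        ∀ p ∈ F, MvPolynomial.aeval (coords n A) p = 0 := by
  obtain ⟨T, hT, hTC⟩ := (@isClosed_induced_iff _ _ (zariskiAffine (Coord n)) _ _).1
    ((@isClosed_coinduced _ _ (zariskiProdGL n) _ _).1 hC)
  obtain ⟨Z, hZ, rfl⟩ := isClosed_induced_iff.1 hT
  obtain ⟨F, rfl⟩ := (PrimeSpectrum.isClosed_iff_zeroLocus _).1 hZ
  exact ⟨F, fun A => (Set.ext_iff.1 hTC A).symm.trans <| forall₂_congr fun p _ =>
    MvPolynomial.mem_vanishingIdeal_singleton_iff _ _⟩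

/-- The coordinates `coords`, as a linear map on the matrices over the product ring. -/
def coordsLinearMap (n : Fin (k + 1) → ℕ) :
    Matrix (Fin 2) (Fin 2) (∀ i, TruncPoly (n i)) →ₗ[ℂ] Coord n → ℂ :=
  LinearMap.pi fun c => LinearMap.proj c.2.2.2 ∘ₗ (coeffsEquiv (n c.1)).toLinearMap ∘ₗ
    LinearMap.proj c.1 ∘ₗ Matrix.entryLinearMap ℂ _ c.2.1 c.2.2.1

theorem coordsLinearMap_coe (u : GL (Fin 2) (∀ i, TruncPoly (n i))) :
    coordsLinearMap n u.val = coords n (glPiEquiv u) :=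
  funext fun c => congrFun (congrFun (coe_coeffsEquiv (n c.1)) _) _

theorem denseRange_phi (ht : Function.Injective t) (ht0 : ∀ i, t i ≠ 0) (ht1 : ∀ i, t i ≠ 1)
    (hx0 : x ≠ 0) (hx1 : x ≠ 1) (hx : ∀ i, x ≠ t i) {N : ℕ} (hN : 3 * ∑ i, (n i + 1) ≤ N) :
    @DenseRange (ProdPGL n) (zariskiProdPGL n) _ (phi n t x hx N) := by
  let := zariskiProdPGL n
  refine dense_iff_closure_eq.2 (Set.eq_univ_of_forall fun w => ?_)
  obtain ⟨F, hF⟩ := exists_mem_iff_of_isClosed_zariskiProdPGL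
    (isClosed_closure (s := Set.range (phi n t x hx N)))
  replace hF (u) : glPiToPGL u ∈ closure (Set.range (phi n t x hx N)) ↔
      ∀ p ∈ F, MvPolynomial.aeval (coordsLinearMap n u.val) p = 0 := by
    rw [coordsLinearMap_coe]
    exact hF (glPiEquiv u)
  obtain ⟨u, rfl⟩ := glPiToPGL_surjective w
  refine (hF u).2 fun p hp => aeval_eq_zero_of_curve_products hx0 hx1 (adjoin_piParam n ht)
    (by simpa using isUnit_piParam_sub n ht0) (by simpa using isUnit_piParam_sub n ht1)
    (isUnit_piParam_sub n fun i => (hx i).symm) (range_coe_param x) (coe_gTupleLift hx)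
    (finrank_pi_truncPoly n ▸ hN) _ (fun u hu => ?_) u
  exact (hF u).1 (subset_closure (glPiToPGL_mem_range_phi hx hu)) p hp

end ProdPGL

end WildHecke

end

theorem lemma3p10_general (k : ℕ) (n : Fin (k + 1) → ℕ) (t : Fin (k + 1) → ℂ)
    (ht : Function.Injective t) (ht0 : ∀ i, t i ≠ 0) (ht1 : ∀ i, t i ≠ 1)
    (x : ℂ) (hx0 : x ≠ 0) (hx1 : x ≠ 1) (hx : ∀ i, x ≠ t i) :
    Dense (Subgroup.closure (Set.range (WildHecke.gTuple n t x hx)) : Set (WildHecke.ProdPGL n)) ∧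
    ∀ N, 3 * ∑ i, (n i + 1) ≤ N →
      @DenseRange (WildHecke.ProdPGL n) (WildHecke.zariskiProdPGL n) (Fin N → WildHecke.Param x)
        (WildHecke.phi n t x hx N) :=
  ⟨WildHecke.dense_closure_range_gTuple ht ht0 ht1 hx0 hx1 hx,
    fun _ => WildHecke.denseRange_phi ht ht0 ht1 hx0 hx1 hx⟩

theorem lemma3p10 (k : ℕ) (n : Fin (k + 1) → ℕ) (t : Fin (k + 1) → ℂ)
    (ht : Function.Injective t) (ht0 : ∀ i, t i ≠ 0) (ht1 : ∀ i, t i ≠ 1)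
    (x : ℂ) (hx0 : x ≠ 0) (hx1 : x ≠ 1) (hx : ∀ i, x ≠ t i) :
    Dense (Subgroup.closure (Set.range (WildHecke.gTuple n t x hx)) : Set (WildHecke.ProdPGL n)) ∧
    ∀ m : ℕ, m = (∑ i, (n i + 1)) + 1 →
      @DenseRange (WildHecke.ProdPGL n) (WildHecke.zariskiProdPGL n) (Fin (4 * m) → WildHecke.Param x)
        (WildHecke.phi n t x hx (4 * m)) := by
  obtain ⟨hdense, hphi⟩ := lemma3p10_general k n t ht ht0 ht1 x hx0 hx1 hx
  exact ⟨hdense, fun m hm => hphi (4 * m) (by omega)⟩
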